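/- Let $N\ge 1$ be an integer, $\lambda\in\mathbb{R}\setminus\{0\}$, $T>0$, $N_0=2N$, $s>3+2N_0=3+4N$ and $p\in(2,\infty)$. Write $X^{\sigma}=X^\sigma(\mathbb{R}^2)=\{f\in L^\infty(\mathbb{R}^2):\nabla f\in H^{\sigma-1}(\mathbb{R}^2)\}$, normed by $\|f\|_{L^\infty}+\|\nabla f\|_{H^{\sigma-1}}$; below, $L^{2+}$ stands for $L^q$ with some $q\in(2,\infty)$. Let $\Phi\in C^1(\mathbb{R}^2;\mathbb{R})$ with $\nabla\Phi\in X^{s+1}\cap L^p$, and let $A^\varepsilon\in H^s(\mathbb{R}^2;\mathbb{C})$ ($0<\varepsilon\le1$) be bounded in $H^s$ uniformly in $\varepsilon$ with $A^\varepsilon=A_0+\varepsilon A_1+\dots+\varepsilon^{N_0}A_{N_0}+o(\varepsilon^{N_0})$ in $H^s$ as $\varepsilon\to0$, for some $A_j\in H^s$. For $0<\varepsilon\le1$ let $$a^\varepsilon\in C([0,T);H^s)\cap C^1((0,T);H^{s-2}),\qquad \phi^\varepsilon\in C^1([0,T)\times\mathbb{R}^2;\mathbb{R}),\qquad \nabla\phi^\varepsilon\in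 C([0,T);X^{s+1}\cap L^p)$$ be a solution of $$\begin{cases}\partial_t a^\varepsilon+\nabla\phi^\varepsilon\cdot\nabla a^\varepsilon+\tfrac12 a^\varepsilon\Delta\phi^\varepsilon=i\tfrac{\varepsilon}{2}\Delta a^\varepsilon,\\ \partial_t\phi^\varepsilon+\tfrac12|\nabla\phi^\varepsilon|^2+\lambda P^\varepsilon=0,\\ P^\varepsilon(t,x)=-\frac1{2\pi}\int_{\mathbb{R}^2}\Big(\log\frac{|x-y|}{|y|}\Big)|a^\varepsilon(t,y)|^2\,dy,\\ a^\varepsilon(0,x)=A^\varepsilon(x),\quad \phi^\varepsilon(0,x)=\Phi(x).\end{cases}$$ Let $a_j\in C([0,T);H^{s-2j})$ and $\phi_j\in C^1([0,T)\times\mathbb{R}^2;\mathbb{R})$ with $\nabla\phi_j(t)\in X^{s+1-2j}\cap L^{2+}$ for $t\in[0,T)$ ($0\le j\le N_0$) be the coefficients of the expansion of this solution as $\varepsilon\to0$, i.e. $$\begin{aligned}a^\varepsilon&=a_0+\varepsilon a_1+\dots+\varepsilon^{N_0}a_{N_0}+o(\varepsilon^{N_0})&&\text{in }L^\infty([0,T);H^{s-2N_0}),\\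 \phi^\varepsilon&=\phi_0+\varepsilon\phi_1+\dots+\varepsilon^{N_0}\phi_{N_0}+o(\varepsilon^{N_0})&&\text{in }L^\infty([0,T);L^\infty_{\mathrm{loc}}),\\ \nabla\phi^\varepsilon&=\nabla\phi_0+\dots+\varepsilon^{N_0}\nabla\phi_{N_0}+o(\varepsilon^{N_0})&&\text{in }L^\infty([0,T);X^{s+1-2N_0}\cap L^{2+}).\end{aligned}$$ Let $\alpha\in(0,1]$. If $$(1+|x|)^{\alpha/2^{j}}\,|a_j(t)|^2\in L^1(\mathbb{R}^2),\qquad j=0,1,\dots,N,$$ holds at the initial time $t=0$, then it holds for all $t\in[0,T)$. -/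

import Mathlib

open MeasureTheory Set Filter Topology TemperedDistribution
open scoped ENNReal SchwartzMap ContDiff

namespace SchrodingerPoisson

/-- The plane `ℝ²` with its Euclidean norm. -/
abbrev Plane : Type := EuclideanSpace ℝ (Fin 2)

/-- The `i`-th standard basis vector of `ℝ²`. -/
noncomputable def basisVec (i : Fin 2) : Plane := EuclideanSpace.single i (1 : ℝ)

/-- The `H^s(ℝ²)` norm (`s ≥ 0`) of a function: the `L²` norm of its Bessel potential of order `s`;
it is `⊤` when `f` is not in `L²` or its Bessel potential is not in `L²`. -/
noncomputable def sobNorm (s : ℝ) (f : Plane → ℂ) : ℝ≥0∞ :=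
  ⨅ (g : Lp ℂ 2 (volume : Measure Plane))
    (_ : ∃ h : MemLp f 2 (volume : Measure Plane),
      besselPotential Plane ℂ s ((h.toLp f : Lp ℂ 2 (volume : Measure Plane)) : 𝓢'(Plane, ℂ)) = g),
    ‖g‖ₑ

/-- `f ∈ H^s(ℝ²)`. -/
def MemH (s : ℝ) (f : Plane → ℂ) : Prop := sobNorm s f < ⊤

theorem memH_iff (s : ℝ) (f : Plane → ℂ) :
    MemH s f ↔ ∃ h : MemLp f 2 (volume : Measure Plane),
      MemSobolev s 2 ((h.toLp f : Lp ℂ 2 (volume : Measure Plane)) : 𝓢'(Plane, ℂ)) := by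
  unfold MemH sobNorm MemSobolev
  constructor
  · intro h
    simp only [iInf_lt_iff] at h
    obtain ⟨g, ⟨h, hg⟩, -⟩ := h
    exact ⟨h, g, hg⟩
  · rintro ⟨h, g, hg⟩
    simp only [iInf_lt_iff]
    exact ⟨g, ⟨h, hg⟩, enorm_lt_top⟩

/-- `g` is the weak (distributional) partial derivative `∂ᵢ f` on `ℝ²`. -/
def HasWeakDeriv (i : Fin 2) (f g : Plane → ℂ) : Prop :=
  LocallyIntegrable f (volume : Measure Plane) ∧ LocallyIntegrable g (volume : Measure Plane) ∧
    ∀ η : Plane → ℝ, ContDiff ℝ ∞ η → HasCompactSupport η →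
      ∫ x, f x * (fderiv ℝ η x (basisVec i) : ℂ) = -∫ x, g x * (η x : ℂ)

/-- The norm of the Zhidkov space `X^s(ℝ²) = {f ∈ L^∞ : ∇f ∈ H^(s-1)}`; it is `⊤` when `f` does not
belong to that space. The weak derivatives are unique up to null sets, so each infimum is the
`H^(s-1)` norm of `∂ᵢ f`. -/
noncomputable def zhidkovNorm (s : ℝ) (f : Plane → ℂ) : ℝ≥0∞ :=
  eLpNorm f ⊤ (volume : Measure Plane) +
    ∑ i : Fin 2, ⨅ (g : Plane → ℂ) (_ : HasWeakDeriv i f g), sobNorm (s - 1) g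

/-- The norm of `X^s(ℝ²) ∩ L^p(ℝ²)` for a vector field with components `V 0`, `V 1`. -/
noncomputable def fieldNorm (s p : ℝ) (V : Fin 2 → Plane → ℂ) : ℝ≥0∞ :=
  ∑ i : Fin 2, (zhidkovNorm s (V i) + eLpNorm (V i) (ENNReal.ofReal p) (volume : Measure Plane))

/-- The (classical) gradient of a real function, with components regarded as complex numbers. -/
noncomputable def grad (f : Plane → ℝ) (i : Fin 2) (x : Plane) : ℂ :=
  ((fderiv ℝ f x (basisVec i) : ℝ) : ℂ)

/-- The Poisson potential `-(2π)⁻¹ ∫ log (|x - y| / |y|) |a(y)|² dy`. -/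
noncomputable def poisson (a : Plane → ℂ) (x : Plane) : ℝ :=
  -(1 / (2 * Real.pi)) * ∫ y, Real.log (‖x - y‖ / ‖y‖) * ‖a y‖ ^ 2

/-- `a ∈ C(I; H^s(ℝ²))`. -/
def ContInH (s : ℝ) (I : Set ℝ) (a : ℝ → Plane → ℂ) : Prop :=
  ∀ t ∈ I, MemH s (a t) ∧ Tendsto (fun τ => sobNorm s (a τ - a t)) (𝓝[I] t) (𝓝 0)

/-- `b = ∂ₜ a` on the open set `I`, as a derivative with values in `H^s(ℝ²)`. -/
def HasTimeDerivInH (s : ℝ) (I : Set ℝ) (a b : ℝ → Plane → ℂ) : Prop :=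
  ∀ t ∈ I, Tendsto (fun h : ℝ => sobNorm s ((h : ℂ)⁻¹ • (a (t + h) - a t) - b t))
    (𝓝[≠] 0) (𝓝 0)

/-- `V ∈ C(I; X^s(ℝ²) ∩ L^p(ℝ²))` for a time-dependent vector field `V`. -/
def ContInField (s p : ℝ) (I : Set ℝ) (V : ℝ → Fin 2 → Plane → ℂ) : Prop :=
  ∀ t ∈ I, fieldNorm s p (V t) < ⊤ ∧
    Tendsto (fun τ => fieldNorm s p (V τ - V t)) (𝓝[I] t) (𝓝 0)

/-- `φ ∈ C¹([0,T) × ℝ²)`. -/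
def C1OnStrip (T : ℝ) (φ : ℝ → Plane → ℝ) : Prop :=
  ContDiffOn ℝ 1 (fun z : ℝ × Plane => φ z.1 z.2) (Ico 0 T ×ˢ univ)

/-- At one instant, `da + ∇φ · ∇a + ½ a Δφ = i (ε/2) Δa` almost everywhere, where
`∇a = (p 0, p 1)`, `Δa = q 0 + q 1` and `Δφ = r 0 + r 1` are weak derivatives. -/
def AmplitudeEq (ε : ℝ) (da a : Plane → ℂ) (φ : Plane → ℝ) : Prop :=
  ∃ p q r : Fin 2 → Plane → ℂ,
    (∀ i, HasWeakDeriv i a (p i) ∧ HasWeakDeriv i (p i) (q i) ∧ HasWeakDeriv i (grad φ i) (r i)) ∧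
    ∀ᵐ x : Plane, da x + ∑ i, grad φ i x * p i x + (1 / 2) * a x * ∑ i, r i x
      = Complex.I * (ε / 2) * ∑ i, q i x

/-- `(a, φ)` solves, on `[0,T)` with parameters `lam` and `ε`, the system
`∂ₜ a + ∇φ · ∇a + ½ a Δφ = i (ε/2) Δa`, `∂ₜ φ + ½ |∇φ|² + lam P = 0`, `P` the Poisson potential of
`|a|²`, with `(a, φ)(0) = (A, Φ)`, in the class
`a ∈ C([0,T); H^s) ∩ C¹((0,T); H^(s-2))`, `φ ∈ C¹([0,T) × ℝ²)`, `∇φ ∈ C([0,T); X^(s+1) ∩ L^p)`. -/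
structure IsSolution (lam ε s p T : ℝ) (A : Plane → ℂ) (Φ : Plane → ℝ)
    (a : ℝ → Plane → ℂ) (φ : ℝ → Plane → ℝ) : Prop where
  amplitude_cont : ContInH s (Ico 0 T) a
  phase_C1 : C1OnStrip T φ
  phase_cont : ContInField (s + 1) p (Ico 0 T) (fun t => grad (φ t))
  amplitude_eq : ∃ da : ℝ → Plane → ℂ, ContInH (s - 2) (Ioo 0 T) da ∧
    HasTimeDerivInH (s - 2) (Ioo 0 T) a da ∧ ∀ t ∈ Ioo 0 T, AmplitudeEq ε (da t) (a t) (φ t)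
  phase_eq : ∀ t ∈ Ico 0 T, ∀ x : Plane,
    HasDerivWithinAt (fun τ => φ τ x)
      (-((1 / 2) * ∑ i, (fderiv ℝ (φ t) x (basisVec i)) ^ 2 + lam * poisson (a t) x)) (Ico 0 T) t
  amplitude_init : a 0 =ᵐ[volume] A
  phase_init : φ 0 = Φ

/-- The assumption on the data with expansion level `N₀`: `A^ε` (`0 < ε ≤ 1`) is bounded in `H^s`
and `A^ε = A₀ + ε A₁ + ⋯ + ε^N₀ A_N₀ + o(ε^N₀)` in `H^s` as `ε → 0`; `Φ ∈ C¹` and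
`∇Φ ∈ X^(s+1) ∩ L^p`. -/
structure DataAssumption (N₀ : ℕ) (s p : ℝ) (A : ℝ → Plane → ℂ) (Φ : Plane → ℝ) : Prop where
  regularity : 3 + 2 * (N₀ : ℝ) < s
  exponent : 2 < p
  amplitude_bdd : ∃ C : ℝ, ∀ ε ∈ Ioc (0 : ℝ) 1, sobNorm s (A ε) ≤ ENNReal.ofReal C
  amplitude_expansion : ∃ Acoef : ℕ → Plane → ℂ, (∀ j ≤ N₀, MemH s (Acoef j)) ∧
    ∀ δ > 0, ∀ᶠ ε : ℝ in 𝓝[>] 0,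
      sobNorm s (A ε - ∑ j ∈ Finset.range (N₀ + 1), (ε : ℂ) ^ j • Acoef j)
        ≤ ENNReal.ofReal (δ * ε ^ N₀)
  phase_C1 : ContDiff ℝ 1 Φ
  phase_mem : fieldNorm (s + 1) p (grad Φ) < ⊤

/-- `acoef j`, `φcoef j` (`j ≤ N₀`) are the coefficients of the expansion of the family
`(a^ε, φ^ε)` on `[0,T)` in powers of `ε`, up to `o(ε^N₀)`: for `a^ε` in `L^∞([0,T); H^(s-2N₀))`, for
`φ^ε` in `L^∞([0,T); L^∞_loc)` and for `∇φ^ε` in `L^∞([0,T); X^(s+1-2N₀) ∩ L^(2+))`, where `L^(2+)`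
stands for `L^q` with some `q ∈ (2,∞)`. -/
structure IsExpansion (N₀ : ℕ) (s T : ℝ) (a : ℝ → ℝ → Plane → ℂ) (φ : ℝ → ℝ → Plane → ℝ)
    (acoef : ℕ → ℝ → Plane → ℂ) (φcoef : ℕ → ℝ → Plane → ℝ) : Prop where
  amplitude_mem : ∀ j ≤ N₀, ContInH (s - 2 * j) (Ico 0 T) (acoef j)
  phase_C1 : ∀ j ≤ N₀, C1OnStrip T (φcoef j)
  phase_mem : ∀ j ≤ N₀, ∃ q : ℝ, 2 < q ∧
    ∀ t ∈ Ico 0 T, fieldNorm (s + 1 - 2 * j) q (grad (φcoef j t)) < ⊤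
  amplitude_expansion : ∀ δ > 0, ∀ᶠ ε : ℝ in 𝓝[>] 0, ∀ t ∈ Ico 0 T,
    sobNorm (s - 2 * N₀) (a ε t - ∑ j ∈ Finset.range (N₀ + 1), (ε : ℂ) ^ j • acoef j t)
      ≤ ENNReal.ofReal (δ * ε ^ N₀)
  phase_expansion : ∀ K : Set Plane, IsCompact K → ∀ δ > 0, ∀ᶠ ε : ℝ in 𝓝[>] 0,
    ∀ t ∈ Ico 0 T, ∀ x ∈ K,
      |φ ε t x - ∑ j ∈ Finset.range (N₀ + 1), ε ^ j * φcoef j t x| ≤ δ * ε ^ N₀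
  gradient_expansion : ∃ q : ℝ, 2 < q ∧ ∀ δ > 0, ∀ᶠ ε : ℝ in 𝓝[>] 0, ∀ t ∈ Ico 0 T,
    fieldNorm (s + 1 - 2 * N₀) q
        (grad (φ ε t) - ∑ j ∈ Finset.range (N₀ + 1), (ε : ℂ) ^ j • grad (φcoef j t))
      ≤ ENNReal.ofReal (δ * ε ^ N₀)

/-- `(1 + |x|)^(α / 2^j) |f|² ∈ L¹(ℝ²)`. -/
def WeightedL2 (α : ℝ) (j : ℕ) (f : Plane → ℂ) : Prop :=
  Integrable (fun x : Plane => (1 + ‖x‖) ^ (α / 2 ^ j) * ‖f x‖ ^ 2) (volume : Measure Plane)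

end SchrodingerPoisson

/-!
The coefficient of order `j` is controlled by the weighted energy `∫ w_j |a_j|²`, where `w_j` is a
truncation of `(1 + |x|²) ^ (α / 2 ^ (j + 1))`, which has the growth `|x| ^ (α / 2 ^ j)`. The
argument is an energy estimate for the amplitude equation, read as a linear equation in which `∇φ`
is a given bounded field with square integrable derivatives.

*Equations of the coefficients.* An inverse Vandermonde matrix expresses each coefficient as a
uniform limit of fixed linear combinations of the values of the family at `ε, 2ε, …, (n + 1)ε`
(`exists_extraction`). Hence the coefficients are locally bounded in time, and since the right-hand
side of the amplitude equation has an expansion too (by Cauchy products), they satisfy the equations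
obtained by comparing powers of `ε` (`UniformExpansion.hasDerivAt`, `hasDerivAt_embH_coef`):
`∂ₜ a_j = -∑_{k ≤ j} (∇φ_k · ∇a_{j-k} + ½ a_{j-k} Δφ_k) + (i/2) Δ a_{j-1}`.

*Energy estimate.* In the derivative of `∫ w_j |a_j|²` the term with `∇φ_0` and `a_j` reduces, by
antisymmetry of transport, to `∫ ∇w_j · ∇φ_0 |a_j|²`, which is bounded as `∇w_j` is bounded (the
exponent is at most `1`). The remaining terms contain `a_m` with `m < j`. There, integrating by
parts, all derivatives are moved from `a_m` to `a_j` and to the weight; what is left is bounded by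
unweighted norms and by `‖w_j a_m‖` in `L²` (`exists_energy_bound`). The exponents being halved at
each order, `w_j² ≤ w_m`, so that this is controlled by the energy of `a_m`, which is bounded by
induction (`exists_energy_weight_le`). All bounds are uniform in the truncation, which is removed at
the end (`integrable_of_energy_le`).

The estimates are carried out in a model of `H²(ℝ²)`: an element `u` of `L²` stands for the function
`embH u` with Bessel potential `u`, and `derH i`, `derH₂ i`, `supH` give its derivatives and its
image in `L^∞` as bounded operators. A component of a phase gradient is recorded by the pair formed
by itself in `L^∞` and its derivative in `L²`.
-/

open scoped FourierTransform LineDeriv InnerProductSpace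

namespace SchrodingerPoisson

/-! ### Expansions in powers of a small parameter -/

section Expansions

variable {E F G : Type*} [NormedAddCommGroup E]

/-- The functions `c j`, `j ≤ n`, are bounded on `I`. -/
def CoefBounded (n : ℕ) (I : Set ℝ) (c : ℕ → ℝ → E) : Prop :=
  ∃ M : ℝ, 0 ≤ M ∧ ∀ j ≤ n, ∀ t ∈ I, ‖c j t‖ ≤ M

theorem CoefBounded.of_forall {n : ℕ} {I : Set ℝ} {c : ℕ → ℝ → E}
    (h : ∀ j ≤ n, ∃ M : ℝ, ∀ t ∈ I, ‖c j t‖ ≤ M) : CoefBounded n I c := by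
  choose! M hM using h
  refine ⟨∑ j ∈ Finset.range (n + 1), |M j|, Finset.sum_nonneg fun _ _ => abs_nonneg _,
    fun j hj t ht => ((hM j hj t ht).trans (le_abs_self _)).trans ?_⟩
  exact Finset.single_le_sum (f := fun j => |M j|) (fun _ _ => abs_nonneg _)
    (Finset.mem_range.2 (Nat.lt_succ_of_le hj))

theorem CoefBounded.mono {n : ℕ} {I J : Set ℝ} {c : ℕ → ℝ → E} (h : CoefBounded n I c)
    (hJ : J ⊆ I) : CoefBounded n J c := by
  obtain ⟨M, hM, h⟩ := h
  exact ⟨M, hM, fun j hj t ht => h j hj t (hJ ht)⟩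

variable [NormedSpace ℝ E] [NormedAddCommGroup F] [NormedSpace ℝ F] [NormedAddCommGroup G]
  [NormedSpace ℝ G]

/-- `f ε t = c 0 t + ε c 1 t + ⋯ + ε ^ n c n t + o(ε ^ n)` as `ε → 0⁺`, uniformly in `t ∈ I`. -/
def UniformExpansion (n : ℕ) (I : Set ℝ) (f : ℝ → ℝ → E) (c : ℕ → ℝ → E) : Prop :=
  ∀ δ > 0, ∀ᶠ ε : ℝ in 𝓝[>] 0, ∀ t ∈ I,
    ‖f ε t - ∑ j ∈ Finset.range (n + 1), ε ^ j • c j t‖ ≤ δ * ε ^ n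

theorem CoefBounded.clm {n : ℕ} {I : Set ℝ} {c : ℕ → ℝ → E} (h : CoefBounded n I c)
    (L : E →L[ℝ] F) : CoefBounded n I (fun j t => L (c j t)) := by
  obtain ⟨M, hM, h⟩ := h
  exact ⟨‖L‖ * M, by positivity, fun j hj t ht => L.le_opNorm_of_le (h j hj t ht)⟩

/-- The inverse Vandermonde matrix with nodes `1, …, n + 1`. -/
theorem exists_vandermonde_inverse (n : ℕ) : ∃ C : ℕ → ℕ → ℝ, ∀ j ≤ n, ∀ m ≤ n,
    ∑ k ∈ Finset.range (n + 1), C j k * ((k : ℝ) + 1) ^ m = if m = j then 1 else 0 := by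
  let v : Fin (n + 1) → ℝ := fun k => (k : ℝ) + 1
  have hv : Function.Injective v := by
    intro a b hab
    have : (a : ℝ) = b := by simpa [v] using hab
    exact Fin.ext (by exact_mod_cast this)
  have hdet : IsUnit (Matrix.vandermonde v).det :=
    (Matrix.det_vandermonde_ne_zero_iff.2 hv).isUnit
  let W : Fin (n + 1) → Fin (n + 1) → ℝ := fun a b => ((Matrix.vandermonde v)⁻¹ : Matrix _ _ ℝ) a b
  refine ⟨fun j k => if h : j < n + 1 ∧ k < n + 1 then W ⟨j, h.1⟩ ⟨k, h.2⟩ else 0,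
    fun j hj m hm => ?_⟩
  have h := congrFun (congrFun (Matrix.nonsing_inv_mul _ hdet) ⟨j, Nat.lt_succ_of_le hj⟩)
    ⟨m, Nat.lt_succ_of_le hm⟩
  rw [Matrix.mul_apply, Matrix.one_apply] at h
  rw [← Fin.sum_univ_eq_sum_range (fun k => _ * ((k : ℝ) + 1) ^ m)]
  simp only [Fin.mk.injEq] at h
  rw [show (if m = j then (1 : ℝ) else 0) = if j = m then 1 else 0 by simp [eq_comm], ← h]
  refine Finset.sum_congr rfl fun k _ => ?_
  beta_reduce
  rw [dif_pos ⟨Nat.lt_succ_of_le hj, k.2⟩]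
  simp [W, v, Matrix.vandermonde_apply]

/-- The coefficients of an expansion are uniform limits of fixed linear combinations of the values
of the function at `ε, 2ε, …, (n+1)ε`. -/
theorem exists_extraction (n : ℕ) : ∃ C : ℕ → ℕ → ℝ, ∀ (E : Type _) [NormedAddCommGroup E]
    [NormedSpace ℝ E] (I : Set ℝ) (f : ℝ → ℝ → E) (c : ℕ → ℝ → E), UniformExpansion n I f c →
    ∀ j ≤ n, ∀ η > 0, ∀ᶠ ε : ℝ in 𝓝[>] 0, ∀ t ∈ I,
      ‖(ε ^ j)⁻¹ • ∑ k ∈ Finset.range (n + 1), C j k • f (((k : ℝ) + 1) * ε) t - c j t‖ ≤ η := by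
  obtain ⟨C, hC⟩ := exists_vandermonde_inverse n
  refine ⟨C, fun E _ _ I f c h j hj η hη => ?_⟩
  set K : ℝ := ∑ k ∈ Finset.range (n + 1), |C j k| * ((k : ℝ) + 1) ^ n with hK
  have hK0 : 0 ≤ K := by positivity
  have hev : ∀ k ∈ Finset.range (n + 1), ∀ᶠ ε : ℝ in 𝓝[>] 0, ∀ t ∈ I,
      ‖f (((k : ℝ) + 1) * ε) t - ∑ m ∈ Finset.range (n + 1), (((k : ℝ) + 1) * ε) ^ m • c m t‖
        ≤ η / (K + 1) * (((k : ℝ) + 1) * ε) ^ n := by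
    intro k _
    have ht : Tendsto (fun ε : ℝ => ((k : ℝ) + 1) * ε) (𝓝[>] 0) (𝓝[>] 0) := by
      refine tendsto_nhdsWithin_of_tendsto_nhds_of_eventually_within _ ?_ ?_
      · have : Tendsto (fun ε : ℝ => ((k : ℝ) + 1) * ε) (𝓝 0) (𝓝 (((k : ℝ) + 1) * 0)) :=
          (continuous_const.mul continuous_id).tendsto 0
        rw [mul_zero] at this
        exact this.mono_left nhdsWithin_le_nhds
      · filter_upwards [self_mem_nhdsWithin] with ε hε
        exact Set.mem_Ioi.2 (mul_pos (by positivity) hε)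
    exact ht.eventually (h (η / (K + 1)) (by positivity))
  filter_upwards [(Filter.eventually_all_finset _).2 hev, self_mem_nhdsWithin,
    Ioc_mem_nhdsGT (zero_lt_one (α := ℝ))] with ε hε hε0 hε1 t ht
  have hε0 : 0 < ε := hε0
  have key : ∑ k ∈ Finset.range (n + 1), C j k •
      ∑ m ∈ Finset.range (n + 1), (((k : ℝ) + 1) * ε) ^ m • c m t = ε ^ j • c j t := by
    simp_rw [Finset.smul_sum, smul_smul]
    rw [Finset.sum_comm]
    rw [Finset.sum_eq_single_of_mem j (Finset.mem_range.2 (Nat.lt_succ_of_le hj))]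
    · rw [← Finset.sum_smul]
      congr 1
      simp_rw [mul_pow, ← mul_assoc]
      rw [← Finset.sum_mul, hC j hj j hj]; simp
    · intro m hm hmj
      rw [← Finset.sum_smul]
      simp_rw [mul_pow, ← mul_assoc]
      rw [← Finset.sum_mul, hC j hj m (Nat.lt_succ_iff.1 (Finset.mem_range.1 hm))]; simp [hmj]
  have hcj : c j t = (ε ^ j)⁻¹ • (ε ^ j • c j t) := by
    rw [smul_smul, inv_mul_cancel₀ (by positivity), one_smul]
  rw [hcj, ← smul_sub, ← key, ← Finset.sum_sub_distrib, norm_smul, norm_inv, norm_pow,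
    Real.norm_of_nonneg hε0.le]
  have hb : ‖∑ k ∈ Finset.range (n + 1), (C j k • f (((k : ℝ) + 1) * ε) t - C j k •
      ∑ m ∈ Finset.range (n + 1), (((k : ℝ) + 1) * ε) ^ m • c m t)‖ ≤ η / (K + 1) * K * ε ^ n := by
    rw [hK, Finset.mul_sum, Finset.sum_mul]
    refine norm_sum_le_of_le _ fun k hk => ?_
    rw [← smul_sub, norm_smul, Real.norm_eq_abs]
    refine (mul_le_mul_of_nonneg_left (hε k hk t ht) (abs_nonneg _)).trans_eq ?_
    rw [mul_pow]; ring
  have hpow : ε ^ n ≤ ε ^ j := pow_le_pow_of_le_one hε0.le hε1.2 hj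
  calc (ε ^ j)⁻¹ * _ ≤ (ε ^ j)⁻¹ * (η / (K + 1) * K * ε ^ j) := by
        gcongr; exact hb.trans (by gcongr)
    _ = η * (K / (K + 1)) := by field_simp
    _ ≤ η * 1 := by gcongr; exact (div_le_one (by positivity)).2 (by linarith)
    _ = η := mul_one _

theorem eventually_mul_mem_Ioc (n : ℕ) : ∀ᶠ ε : ℝ in 𝓝[>] 0, ∀ k ∈ Finset.range (n + 1),
    ((k : ℝ) + 1) * ε ∈ Ioc (0 : ℝ) 1 := by
  filter_upwards [Ioc_mem_nhdsGT (show (0 : ℝ) < 1 / (n + 1) by positivity)] with ε hε k hk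
  have hk' : (k : ℝ) + 1 ≤ n + 1 := by exact_mod_cast Finset.mem_range.1 hk
  refine ⟨mul_pos (by positivity) hε.1, ?_⟩
  calc ((k : ℝ) + 1) * ε ≤ (n + 1) * (1 / (n + 1)) := by
        apply mul_le_mul hk' hε.2 hε.1.le (by positivity)
    _ = 1 := by field_simp

/-- The coefficients inherit boundedness from the expanded family, by extraction at a single `ε`. -/
theorem UniformExpansion.coefBounded {n : ℕ} {I J : Set ℝ} {f : ℝ → ℝ → E} {c : ℕ → ℝ → E}
    (h : UniformExpansion n I f c) (hJ : J ⊆ I)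
    (hb : ∀ ε ∈ Ioc (0 : ℝ) 1, ∃ M : ℝ, ∀ t ∈ J, ‖f ε t‖ ≤ M) : CoefBounded n J c := by
  refine CoefBounded.of_forall fun j hj => ?_
  obtain ⟨C, hC⟩ := exists_extraction n
  obtain ⟨ε, h1, h2⟩ := ((hC E I f c h j hj 1 one_pos).and (eventually_mul_mem_Ioc n)).exists
  choose! M hM using fun k hk => hb _ (h2 k hk)
  refine ⟨1 + ‖(ε ^ j)⁻¹‖ * ∑ k ∈ Finset.range (n + 1), |C j k| * M k, fun t ht => ?_⟩
  have h3 := h1 t (hJ ht)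
  rw [norm_sub_rev] at h3
  refine (norm_le_norm_sub_add _ _).trans (add_le_add h3 ?_)
  rw [norm_smul]
  gcongr
  refine norm_sum_le_of_le _ fun k hk => ?_
  rw [norm_smul, Real.norm_eq_abs]
  gcongr
  exact hM k hk t ht

/-- If a family and its time derivative both have expansions, the coefficients are differentiated
term by term: the combinations of `exists_extraction` converge uniformly together with their
derivatives. -/
theorem UniformExpansion.hasDerivAt {n : ℕ} {I : Set ℝ} (hI : IsOpen I) {f g : ℝ → ℝ → E}
    {c d : ℕ → ℝ → E} (hf : UniformExpansion n I f c) (hg : UniformExpansion n I g d)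
    (h : ∀ ε ∈ Ioc (0 : ℝ) 1, ∀ t ∈ I, HasDerivAt (f ε) (g ε t) t) {j : ℕ} (hj : j ≤ n)
    {t : ℝ} (ht : t ∈ I) : HasDerivAt (c j) (d j t) t := by
  obtain ⟨C, hC⟩ := exists_extraction n
  refine hasDerivAt_of_tendstoUniformlyOn (l := 𝓝[>] (0 : ℝ))
    (f := fun ε t => (ε ^ j)⁻¹ • ∑ k ∈ Finset.range (n + 1), C j k • f (((k : ℝ) + 1) * ε) t)
    (f' := fun ε t => (ε ^ j)⁻¹ • ∑ k ∈ Finset.range (n + 1), C j k • g (((k : ℝ) + 1) * ε) t)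
    hI ?_ ?_ ?_ ht
  · rw [Metric.tendstoUniformlyOn_iff]
    intro η hη
    filter_upwards [hC E I g d hg j hj (η / 2) (by positivity)] with ε hε t ht
    rw [dist_comm, dist_eq_norm]
    exact (hε t ht).trans_lt (by linarith)
  · filter_upwards [eventually_mul_mem_Ioc n] with ε hε t ht
    exact (HasDerivAt.fun_sum fun k hk => (h _ (hε k hk) t ht).const_smul (C j k)).const_smul _
  · intro t ht
    rw [Metric.tendsto_nhds]
    intro η hη
    filter_upwards [hC E I f c hf j hj (η / 2) (by positivity)] with ε hε
    rw [dist_eq_norm]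
    exact (hε t ht).trans_lt (by linarith)

theorem UniformExpansion.mono {n : ℕ} {I J : Set ℝ} {f : ℝ → ℝ → E} {c : ℕ → ℝ → E}
    (h : UniformExpansion n I f c) (hJ : J ⊆ I) : UniformExpansion n J f c :=
  fun δ hδ => (h δ hδ).mono fun _ hε t ht => hε t (hJ ht)

theorem UniformExpansion.clm {n : ℕ} {I : Set ℝ} {f : ℝ → ℝ → E} {c : ℕ → ℝ → E}
    (h : UniformExpansion n I f c) (L : E →L[ℝ] F) :
    UniformExpansion n I (fun ε t => L (f ε t)) (fun j t => L (c j t)) := by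
  intro δ hδ
  filter_upwards [h (δ / (‖L‖ + 1)) (by positivity), self_mem_nhdsWithin] with ε hε hε0 t ht
  have hε0 : 0 < ε := hε0
  have : L (f ε t) - ∑ j ∈ Finset.range (n + 1), ε ^ j • L (c j t) =
      L (f ε t - ∑ j ∈ Finset.range (n + 1), ε ^ j • c j t) := by simp
  rw [this]
  refine (L.le_opNorm_of_le (hε t ht)).trans ?_
  calc ‖L‖ * (δ / (‖L‖ + 1) * ε ^ n) = (‖L‖ / (‖L‖ + 1)) * (δ * ε ^ n) := by ring
    _ ≤ 1 * (δ * ε ^ n) := by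
      gcongr; exact (div_le_one (by positivity)).2 (by linarith)
    _ = _ := one_mul _

theorem UniformExpansion.add {n : ℕ} {I : Set ℝ} {f g : ℝ → ℝ → E} {c d : ℕ → ℝ → E}
    (hf : UniformExpansion n I f c) (hg : UniformExpansion n I g d) :
    UniformExpansion n I (fun ε t => f ε t + g ε t) (fun j t => c j t + d j t) := by
  intro δ hδ
  filter_upwards [hf (δ / 2) (by positivity), hg (δ / 2) (by positivity)] with ε h1 h2 t ht
  simp_rw [smul_add, Finset.sum_add_distrib]
  rw [add_sub_add_comm]
  refine (norm_add_le_of_le (h1 t ht) (h2 t ht)).trans_eq (by ring)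

theorem UniformExpansion.sum {ι : Type*} (s : Finset ι) {n : ℕ} {I : Set ℝ}
    {f : ι → ℝ → ℝ → E} {c : ι → ℕ → ℝ → E} (hf : ∀ i ∈ s, UniformExpansion n I (f i) (c i)) :
    UniformExpansion n I (fun ε t => ∑ i ∈ s, f i ε t) (fun j t => ∑ i ∈ s, c i j t) := by
  classical
  induction s using Finset.induction_on with
  | empty =>
    intro δ hδ
    filter_upwards [self_mem_nhdsWithin] with ε hε t _
    have hε : 0 < ε := hε
    simp only [Finset.sum_empty, smul_zero, Finset.sum_const_zero, sub_zero, norm_zero]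
    positivity
  | insert i s hi ih =>
    simp_rw [Finset.sum_insert hi]
    exact (hf i (Finset.mem_insert_self i s)).add
      (ih fun k hk => hf k (Finset.mem_insert_of_mem hk))

/-- The coefficients of `ε f` when those of `f` are `c`. -/
def shiftCoef (c : ℕ → ℝ → E) : ℕ → ℝ → E
  | 0 => 0
  | j + 1 => c j

theorem UniformExpansion.smul_self {n : ℕ} {I : Set ℝ} {f : ℝ → ℝ → E} {c : ℕ → ℝ → E}
    (h : UniformExpansion n I f c) (hc : CoefBounded n I c) :
    UniformExpansion n I (fun ε t => ε • f ε t) (shiftCoef c) := by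
  obtain ⟨M, hM, hc⟩ := hc
  intro δ hδ
  filter_upwards [h 1 one_pos, Ioc_mem_nhdsGT (show 0 < δ / (1 + M) by positivity)]
    with ε h1 h2 t ht
  have hε : 0 < ε := h2.1
  have key : ε • f ε t - ∑ j ∈ Finset.range (n + 1), ε ^ j • shiftCoef c j t =
      ε • (f ε t - ∑ j ∈ Finset.range (n + 1), ε ^ j • c j t) + ε ^ (n + 1) • c n t := by
    rw [Finset.sum_range_succ', Finset.sum_range_succ (fun j => ε ^ j • c j t)]
    simp only [shiftCoef, Pi.zero_apply, smul_zero, add_zero, smul_sub, smul_add, Finset.smul_sum,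
      smul_smul, ← pow_succ']
    abel
  rw [key]
  have h3 : ‖ε • (f ε t - ∑ j ∈ Finset.range (n + 1), ε ^ j • c j t)‖ ≤ ε * (1 * ε ^ n) := by
    rw [norm_smul, Real.norm_of_nonneg hε.le]
    gcongr; exact h1 t ht
  have h4 : ‖ε ^ (n + 1) • c n t‖ ≤ ε ^ (n + 1) * M := by
    rw [norm_smul, norm_pow, Real.norm_of_nonneg hε.le]
    gcongr; exact hc n le_rfl t ht
  refine (norm_add_le_of_le h3 h4).trans ?_
  calc ε * (1 * ε ^ n) + ε ^ (n + 1) * M = (ε * (1 + M)) * ε ^ n := by ring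
    _ ≤ δ * ε ^ n := by
      gcongr; exact (le_div_iff₀ (by positivity)).1 h2.2

/-- A Cauchy product as a sum over the square of indices, cut off above the antidiagonal. -/
theorem sum_range_sum_range_succ (n : ℕ) (b : ℕ → ℕ → E) (ε : ℝ) :
    ∑ l ∈ Finset.range (n + 1), ε ^ l • ∑ k ∈ Finset.range (l + 1), b k (l - k) =
      ∑ i ∈ Finset.range (n + 1), ∑ j ∈ Finset.range (n + 1),
        if i + j ≤ n then ε ^ (i + j) • b i j else 0 := by
  simp_rw [Finset.smul_sum]
  rw [← Finset.sum_product', ← Finset.sum_filter, Finset.sum_sigma']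
  refine Finset.sum_bij' (fun p _ => (p.2, p.1 - p.2)) (fun q _ => ⟨q.1 + q.2, q.1⟩) ?_ ?_ ?_ ?_ ?_
  · rintro ⟨l, k⟩ h
    simp only [Finset.mem_sigma, Finset.mem_range, Finset.mem_filter, Finset.mem_product] at h ⊢
    omega
  · rintro ⟨i, j⟩ h
    simp only [Finset.mem_sigma, Finset.mem_range, Finset.mem_filter, Finset.mem_product] at h ⊢
    omega
  · rintro ⟨l, k⟩ h
    simp only [Finset.mem_sigma, Finset.mem_range] at h
    have : k + (l - k) = l := by omega
    simp [this]
  · rintro ⟨i, j⟩ _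
    simp
  · rintro ⟨l, k⟩ h
    simp only [Finset.mem_sigma, Finset.mem_range] at h
    have : k + (l - k) = l := by omega
    simp [this]

/-- The Cauchy product of two expansions. -/
theorem UniformExpansion.bilin {n : ℕ} {I : Set ℝ} {f : ℝ → ℝ → E} {g : ℝ → ℝ → F}
    {c : ℕ → ℝ → E} {d : ℕ → ℝ → F} (hf : UniformExpansion n I f c) (hg : UniformExpansion n I g d)
    (hc : CoefBounded n I c) (hd : CoefBounded n I d) (B : E →L[ℝ] F →L[ℝ] G) :
    UniformExpansion n I (fun ε t => B (f ε t) (g ε t))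
      (fun l t => ∑ k ∈ Finset.range (l + 1), B (c k t) (d (l - k) t)) := by
  obtain ⟨M₁, hM₁, hc⟩ := hc
  obtain ⟨M₂, hM₂, hd⟩ := hd
  intro δ hδ
  -- `K` collects the error of the truncated factors, `K'` the terms of the product of the
  -- truncated expansions whose order exceeds `n`
  set m : ℝ := n + 1 with hm
  have hm0 : 0 ≤ m := by positivity
  set K : ℝ := ‖B‖ * (m * M₂ + 1) + ‖B‖ * (m * M₁) + 1 with hK
  have hK0 : 0 < K := by positivity
  set K' : ℝ := m * (m * (‖B‖ * M₁ * M₂)) + 1 with hK'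
  have hK'0 : 0 < K' := by positivity
  set η : ℝ := min 1 (δ / (2 * K)) with hη
  have hη0 : 0 < η := by positivity
  filter_upwards [hf η hη0, hg η hη0, Ioc_mem_nhdsGT (zero_lt_one (α := ℝ)),
    Ioc_mem_nhdsGT (show 0 < δ / (2 * K') by positivity)] with ε h1 h2 h3 h4 t ht
  have hε : 0 < ε := h3.1
  have hpn : ∀ j, ε ^ j ≤ 1 := fun j => pow_le_one₀ hε.le h3.2
  set P := ∑ j ∈ Finset.range (n + 1), ε ^ j • c j t with hP
  set Q := ∑ j ∈ Finset.range (n + 1), ε ^ j • d j t with hQ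
  have hPn : ‖P‖ ≤ m * M₁ := by
    refine (norm_sum_le_of_le _ (f := fun j => ε ^ j • c j t) (n := fun _ => M₁)
      fun j hj => ?_).trans_eq (by simp [hm])
    rw [norm_smul, norm_pow, Real.norm_of_nonneg hε.le]
    exact (mul_le_of_le_one_left (norm_nonneg _) (hpn j)).trans
      (hc j (Nat.lt_succ_iff.1 (Finset.mem_range.1 hj)) t ht)
  have hQn : ‖Q‖ ≤ m * M₂ := by
    refine (norm_sum_le_of_le _ (f := fun j => ε ^ j • d j t) (n := fun _ => M₂)
      fun j hj => ?_).trans_eq (by simp [hm])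
    rw [norm_smul, norm_pow, Real.norm_of_nonneg hε.le]
    exact (mul_le_of_le_one_left (norm_nonneg _) (hpn j)).trans
      (hd j (Nat.lt_succ_iff.1 (Finset.mem_range.1 hj)) t ht)
  have hgn : ‖g ε t‖ ≤ m * M₂ + 1 := by
    have : ‖g ε t - Q‖ ≤ 1 := (h2 t ht).trans
      (mul_le_one₀ (min_le_left _ _) (by positivity) (hpn n))
    have := norm_le_norm_sub_add (g ε t) Q
    linarith
  have hBPQ : B P Q = ∑ i ∈ Finset.range (n + 1), ∑ j ∈ Finset.range (n + 1),
      ε ^ (i + j) • B (c i t) (d j t) := by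
    simp only [hP, hQ, map_sum, map_smul, sum_apply,
      smul_apply, Finset.smul_sum, smul_smul, pow_add]
    rw [Finset.sum_comm]
    refine Finset.sum_congr rfl fun i _ => Finset.sum_congr rfl fun j _ => ?_
    rw [mul_comm]
  have hrem : ‖B P Q - ∑ l ∈ Finset.range (n + 1), ε ^ l •
      ∑ k ∈ Finset.range (l + 1), B (c k t) (d (l - k) t)‖ ≤ ε ^ (n + 1) * K' := by
    rw [sum_range_sum_range_succ n (fun i j => B (c i t) (d j t)), hBPQ,
      ← Finset.sum_sub_distrib]
    simp_rw [← Finset.sum_sub_distrib]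
    have : ∀ i ∈ Finset.range (n + 1), ‖∑ j ∈ Finset.range (n + 1),
        (ε ^ (i + j) • B (c i t) (d j t) -
          if i + j ≤ n then ε ^ (i + j) • B (c i t) (d j t) else 0)‖ ≤
        m * (ε ^ (n + 1) * (‖B‖ * M₁ * M₂)) := by
      intro i hi
      refine (norm_sum_le_of_le _ (n := fun _ => ε ^ (n + 1) * (‖B‖ * M₁ * M₂))
        fun j hj => ?_).trans_eq (by simp [hm])
      split_ifs with hij
      · simp only [sub_self, norm_zero]; positivity
      · rw [sub_zero, norm_smul, norm_pow, Real.norm_of_nonneg hε.le]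
        have h5 : ε ^ (i + j) ≤ ε ^ (n + 1) :=
          pow_le_pow_of_le_one hε.le h3.2 (by omega)
        have h6 : ‖B (c i t) (d j t)‖ ≤ ‖B‖ * M₁ * M₂ :=
          B.le_of_opNorm₂_le_of_le le_rfl
            (hc i (Nat.lt_succ_iff.1 (Finset.mem_range.1 hi)) t ht)
            (hd j (Nat.lt_succ_iff.1 (Finset.mem_range.1 hj)) t ht)
        gcongr
    refine (norm_sum_le_of_le _ this).trans ?_
    simp only [Finset.sum_const, Finset.card_range, nsmul_eq_mul]
    push_cast
    rw [← hm]
    have : 0 < ε ^ (n + 1) := by positivity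
    rw [hK']
    linarith [this]
  have hsplit : B (f ε t) (g ε t) - ∑ l ∈ Finset.range (n + 1), ε ^ l •
      ∑ k ∈ Finset.range (l + 1), B (c k t) (d (l - k) t) =
      B (f ε t - P) (g ε t) + B P (g ε t - Q) + (B P Q - ∑ l ∈ Finset.range (n + 1), ε ^ l •
      ∑ k ∈ Finset.range (l + 1), B (c k t) (d (l - k) t)) := by
    simp only [map_sub, sub_apply]
    abel
  rw [hsplit]
  have e1 : ‖B (f ε t - P) (g ε t)‖ ≤ ‖B‖ * (η * ε ^ n) * (m * M₂ + 1) :=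
    B.le_of_opNorm₂_le_of_le le_rfl (h1 t ht) hgn
  have e2 : ‖B P (g ε t - Q)‖ ≤ ‖B‖ * (m * M₁) * (η * ε ^ n) :=
    B.le_of_opNorm₂_le_of_le le_rfl hPn (h2 t ht)
  refine (norm_add_le_of_le (norm_add_le_of_le e1 e2) hrem).trans ?_
  have e3 : η * K ≤ δ / 2 := by
    calc η * K ≤ δ / (2 * K) * K := by gcongr; exact min_le_right _ _
      _ = δ / 2 := by field_simp
  have e4 : ε * K' ≤ δ / 2 := by
    calc ε * K' ≤ δ / (2 * K') * K' := by gcongr; exact h4.2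
      _ = δ / 2 := by field_simp
  have hen : 0 < ε ^ n := by positivity
  calc _ = (η * (K - 1) + ε * K') * ε ^ n := by rw [hK]; ring
    _ ≤ (δ / 2 + δ / 2) * ε ^ n := by
      gcongr
      exact (by gcongr; linarith : η * (K - 1) ≤ η * K).trans e3
    _ = δ * ε ^ n := by ring

end Expansions

/-! ### Multiplication operators and Fourier multipliers on `L²`, and a model of `H²` -/

/-- The complex Hilbert space `L²(ℝ²)`. -/
abbrev L2 : Type := Lp ℂ 2 (volume : Measure Plane)

/-- The Banach space `L^∞(ℝ²)`. -/
abbrev Linf : Type := Lp ℂ ⊤ (volume : Measure Plane)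

/-- Pointwise multiplication `L^∞ × L² → L²` as a continuous bilinear map. -/
noncomputable def mulL : Linf →L[ℂ] L2 →L[ℂ] L2 :=
  (ContinuousLinearMap.mul ℂ ℂ).holderL volume ⊤ 2 2

theorem coeFn_mulL (V : Linf) (f : L2) : mulL V f =ᵐ[volume] fun x => V x * f x := by
  simpa [mulL] using (ContinuousLinearMap.mul ℂ ℂ).coeFn_holder (r := 2) V f

theorem norm_mulL_le (V : Linf) (f : L2) : ‖mulL V f‖ ≤ ‖V‖ * ‖f‖ := by
  have := (ContinuousLinearMap.mul ℂ ℂ).norm_holder_apply_apply_le (r := 2) V f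
  simpa [mulL] using this

theorem mulL_eq_smul (V : Linf) (f : L2) : mulL V f = (V • f : L2) := by
  apply Lp.ext
  filter_upwards [coeFn_mulL V f, Lp.coeFn_lpSMul (r := 2) V f] with x h1 h2
  rw [h1, h2]; rfl

/-- The Fourier multiplier on `L²` with symbol `G`. -/
noncomputable def fmul (G : Linf) : L2 →L[ℂ] L2 :=
  (Lp.fourierTransformₗᵢ Plane ℂ).symm.toContinuousLinearEquiv.toContinuousLinearMap ∘L mulL G ∘L
    (Lp.fourierTransformₗᵢ Plane ℂ).toContinuousLinearEquiv.toContinuousLinearMap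

theorem fmul_apply (G : Linf) (f : L2) : fmul G f = 𝓕⁻ (mulL G (𝓕 f)) := rfl

theorem norm_fmul_le (G : Linf) (f : L2) : ‖fmul G f‖ ≤ ‖G‖ * ‖f‖ := by
  have h : ‖fmul G f‖ = ‖mulL G (𝓕 f)‖ :=
    (Lp.fourierTransformₗᵢ Plane ℂ).symm.norm_map _
  rw [h]
  refine (norm_mulL_le _ _).trans_eq ?_
  rw [Lp.norm_fourier_eq]

theorem toTemperedDistribution_injective :
    Function.Injective (fun f : L2 => (f : 𝓢'(Plane, ℂ))) := by
  have h := LinearMap.ker_eq_bot.mp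
    (Lp.ker_toTemperedDistributionCLM_eq_bot (F := ℂ) (μ := (volume : Measure Plane)) (p := 2))
  exact h

/-- The multiplier `fmul` agrees with Mathlib's Fourier multiplier on tempered distributions, in
terms of which Bessel potentials are defined. -/
theorem fmul_toTemperedDistribution {g : Plane → ℂ} (hg : g.HasTemperateGrowth)
    (hb : MemLp g ⊤ (volume : Measure Plane)) (f : L2) :
    ((fmul (hb.toLp g) f : L2) : 𝓢'(Plane, ℂ)) = fourierMultiplierCLM ℂ g (f : 𝓢'(Plane, ℂ)) := by
  rw [fmul_apply, ← Lp.fourierInv_toTemperedDistribution_eq, mulL_eq_smul,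
    Lp.toTemperedDistribution_smul_eq hg hb, ← Lp.fourier_toTemperedDistribution_eq,
    fourierMultiplierCLM_apply]

theorem fmul_toLp {g : Plane → ℂ} (hg : g.HasTemperateGrowth)
    (hb : MemLp g ⊤ (volume : Measure Plane)) (f : 𝓢(Plane, ℂ)) :
    fmul (hb.toLp g) (f.toLp 2) = (SchwartzMap.fourierMultiplierCLM ℂ g f).toLp 2 := by
  apply toTemperedDistribution_injective
  simp only
  rw [fmul_toTemperedDistribution hg, Lp.toTemperedDistribution_toLp_eq,
    Lp.toTemperedDistribution_toLp_eq, fourierMultiplierCLM_toTemperedDistributionCLM_eq hg]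

/-- The symbol of the Bessel potential of order `σ`. -/
noncomputable def besselSymbol (σ : ℝ) (x : Plane) : ℂ := ((1 + ‖x‖ ^ 2) ^ (σ / 2) : ℝ)

/-- The symbol of `∂ᵢ`. -/
noncomputable def derivSymbol (i : Fin 2) (x : Plane) : ℂ :=
  (2 * Real.pi * Complex.I) * (inner ℝ x (basisVec i) : ℝ)

theorem besselSymbol_hasTemperateGrowth (σ : ℝ) : (besselSymbol σ).HasTemperateGrowth := by
  unfold besselSymbol
  fun_prop

theorem derivSymbol_hasTemperateGrowth (i : Fin 2) : (derivSymbol i).HasTemperateGrowth := by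
  unfold derivSymbol
  fun_prop

theorem memLp_top_of_temperate {g : Plane → ℂ} (hg : g.HasTemperateGrowth) {C : ℝ}
    (h : ∀ x, ‖g x‖ ≤ C) : MemLp g ⊤ (volume : Measure Plane) :=
  memLp_top_of_bound hg.1.continuous.aestronglyMeasurable C (ae_of_all _ h)

theorem norm_besselSymbol_le_one {σ : ℝ} (hσ : σ ≤ 0) (x : Plane) : ‖besselSymbol σ x‖ ≤ 1 := by
  rw [besselSymbol, Complex.norm_real, Real.norm_eq_abs, abs_of_nonneg (by positivity)]
  exact Real.rpow_le_one_of_one_le_of_nonpos (by simp) (by linarith)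

theorem norm_basisVec (i : Fin 2) : ‖basisVec i‖ = 1 := by simp [basisVec]

theorem norm_derivSymbol_le (i : Fin 2) (x : Plane) : ‖derivSymbol i x‖ ≤ 2 * Real.pi * ‖x‖ := by
  rw [derivSymbol, norm_mul, Complex.norm_real]
  have h : ‖inner ℝ x (basisVec i)‖ ≤ ‖x‖ := by
    simpa [norm_basisVec] using norm_inner_le_norm (𝕜 := ℝ) x (basisVec i)
  have h2 : ‖(2 * Real.pi * Complex.I : ℂ)‖ = 2 * Real.pi := by
    simp [abs_of_pos Real.pi_pos]
  rw [h2]; gcongr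

theorem norm_besselSymbol_neg_two (x : Plane) : ‖besselSymbol (-2) x‖ = (1 + ‖x‖ ^ 2)⁻¹ := by
  rw [besselSymbol, Complex.norm_real, Real.norm_eq_abs, abs_of_nonneg (by positivity)]
  norm_num
  rw [Real.rpow_neg_one]

theorem memLp_besselSymbol {σ : ℝ} (hσ : σ ≤ 0) :
    MemLp (besselSymbol σ) ⊤ (volume : Measure Plane) :=
  memLp_top_of_temperate (besselSymbol_hasTemperateGrowth σ) (norm_besselSymbol_le_one hσ)

theorem memLp_derivSymbol_mul (i : Fin 2) :
    MemLp (derivSymbol i * besselSymbol (-2)) ⊤ (volume : Measure Plane) := by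
  refine memLp_top_of_temperate ((derivSymbol_hasTemperateGrowth i).mul
    (besselSymbol_hasTemperateGrowth _)) (C := 2 * Real.pi) fun x => ?_
  rw [Pi.mul_apply, norm_mul, norm_besselSymbol_neg_two]
  have h := norm_derivSymbol_le i x
  rw [← div_eq_mul_inv, div_le_iff₀ (by positivity)]
  have hx : ‖x‖ ≤ 1 + ‖x‖ ^ 2 := by nlinarith [sq_nonneg (‖x‖ - 1)]
  exact h.trans (by gcongr)

theorem memLp_derivSymbol_sq_mul (i : Fin 2) :
    MemLp (derivSymbol i * (derivSymbol i * besselSymbol (-2))) ⊤ (volume : Measure Plane) := by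
  refine memLp_top_of_temperate ((derivSymbol_hasTemperateGrowth i).mul
    ((derivSymbol_hasTemperateGrowth i).mul
    (besselSymbol_hasTemperateGrowth _))) (C := (2 * Real.pi) ^ 2) fun x => ?_
  rw [Pi.mul_apply, Pi.mul_apply, norm_mul, norm_mul, norm_besselSymbol_neg_two]
  have h := norm_derivSymbol_le i x
  rw [← mul_assoc, ← div_eq_mul_inv, div_le_iff₀ (by positivity)]
  calc _ ≤ (2 * Real.pi * ‖x‖) * (2 * Real.pi * ‖x‖) := by gcongr
    _ ≤ _ := by nlinarith [sq_nonneg (2 * Real.pi)]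

/-- The embedding of `H²(ℝ²)` into `L²(ℝ²)`, where `H²` is identified with `L²` by means of the
Bessel potential: `embH u` is the function whose Bessel potential of order `2` is `u`. -/
noncomputable def embH : L2 →L[ℂ] L2 := fmul ((memLp_besselSymbol (σ := -2) (by norm_num)).toLp _)

/-- The derivative `∂ᵢ : H² → L²`, where `H²` is identified with `L²` as in `embH`. -/
noncomputable def derH (i : Fin 2) : L2 →L[ℂ] L2 := fmul ((memLp_derivSymbol_mul i).toLp _)

/-- The second derivative `∂ᵢ² : H² → L²`, where `H²` is identified with `L²` as in `embH`. -/
noncomputable def derH₂ (i : Fin 2) : L2 →L[ℂ] L2 := fmul ((memLp_derivSymbol_sq_mul i).toLp _)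

/-- Schwartz functions as elements of the model of `H²`: `embH (modelS f) = f`. -/
noncomputable def modelS (f : 𝓢(Plane, ℂ)) : L2 :=
  (SchwartzMap.fourierMultiplierCLM ℂ (besselSymbol 2) f).toLp 2

theorem schwartz_bessel_bessel (f : 𝓢(Plane, ℂ)) (σ : ℝ) :
    SchwartzMap.fourierMultiplierCLM ℂ (besselSymbol (-σ))
      (SchwartzMap.fourierMultiplierCLM ℂ (besselSymbol σ) f) = f := by
  rw [SchwartzMap.fourierMultiplierCLM_fourierMultiplierCLM_apply
    (besselSymbol_hasTemperateGrowth _) (besselSymbol_hasTemperateGrowth _)]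
  have : (besselSymbol (-σ) * besselSymbol σ) = fun _ => (1 : ℂ) := by
    ext x
    simp only [Pi.mul_apply, besselSymbol]
    rw [← Complex.ofReal_mul, ← Real.rpow_add (by positivity)]
    simp [neg_div]
  rw [this]; simp

/-- Schwartz functions are dense in `H²`. The integrations by parts below are extended to `H²` by
this density. -/
theorem denseRange_modelS : DenseRange modelS := by
  have h := SchwartzMap.denseRange_toLpCLM (E := Plane) (F := ℂ) (p := 2)
    (μ := (volume : Measure Plane)) ENNReal.ofNat_ne_top
  have hs : Function.Surjective
      (fun f : 𝓢(Plane, ℂ) => SchwartzMap.fourierMultiplierCLM ℂ (besselSymbol 2) f) := by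
    intro f
    refine ⟨SchwartzMap.fourierMultiplierCLM ℂ (besselSymbol (-2)) f, ?_⟩
    simpa using schwartz_bessel_bessel f (-2)
  have : modelS = (fun g : 𝓢(Plane, ℂ) => SchwartzMap.toLpCLM ℂ ℂ 2 volume g) ∘
    (fun f : 𝓢(Plane, ℂ) => SchwartzMap.fourierMultiplierCLM ℂ (besselSymbol 2) f) := by
    ext1 f; rfl
  rw [this]
  exact h.comp hs.denseRange (by fun_prop)

theorem embH_modelS (f : 𝓢(Plane, ℂ)) : embH (modelS f) = f.toLp 2 := by
  rw [embH, modelS, fmul_toLp (besselSymbol_hasTemperateGrowth _), schwartz_bessel_bessel]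

theorem fourierMultiplier_derivSymbol (i : Fin 2) (f : 𝓢(Plane, ℂ)) :
    SchwartzMap.fourierMultiplierCLM ℂ (derivSymbol i) f = ∂_{basisVec i} f := by
  rw [SchwartzMap.lineDeriv_eq_fourierMultiplierCLM,
    ← SchwartzMap.fourierMultiplierCLM_ofReal ℂ (by fun_prop)]
  have : derivSymbol i = (2 * Real.pi * Complex.I) •
    (fun x : Plane => ((inner ℝ x (basisVec i) : ℝ) : ℂ)) := by ext; simp [derivSymbol]
  rw [this, SchwartzMap.fourierMultiplierCLM_smul (by fun_prop)]
  rfl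

theorem derH_modelS (i : Fin 2) (f : 𝓢(Plane, ℂ)) :
    derH i (modelS f) = (∂_{basisVec i} f : 𝓢(Plane, ℂ)).toLp 2 := by
  have h1 := derivSymbol_hasTemperateGrowth i
  have h2 := besselSymbol_hasTemperateGrowth (-2)
  rw [derH, modelS, fmul_toLp (h1.mul h2),
    ← SchwartzMap.fourierMultiplierCLM_fourierMultiplierCLM_apply h1 h2, schwartz_bessel_bessel,
    fourierMultiplier_derivSymbol]

theorem derH₂_modelS (i : Fin 2) (f : 𝓢(Plane, ℂ)) :
    derH₂ i (modelS f) = (∂_{basisVec i} (∂_{basisVec i} f) : 𝓢(Plane, ℂ)).toLp 2 := by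
  have h1 := derivSymbol_hasTemperateGrowth i
  have h2 := besselSymbol_hasTemperateGrowth (-2)
  rw [derH₂, modelS, fmul_toLp (h1.mul (h1.mul h2)),
    ← SchwartzMap.fourierMultiplierCLM_fourierMultiplierCLM_apply h1 (h1.mul h2),
    ← SchwartzMap.fourierMultiplierCLM_fourierMultiplierCLM_apply h1 h2, schwartz_bessel_bessel,
    fourierMultiplier_derivSymbol, fourierMultiplier_derivSymbol]

/-! ### Weak derivatives, Sobolev embedding, and Sobolev norms in the model -/

theorem hasWeakDeriv_of_lineDeriv (i : Fin 2) (f g : L2)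
    (h : (g : 𝓢'(Plane, ℂ)) = ∂_{basisVec i} (f : 𝓢'(Plane, ℂ))) : HasWeakDeriv i f g := by
  refine ⟨(Lp.memLp f).locallyIntegrable (by norm_num),
    (Lp.memLp g).locallyIntegrable (by norm_num), fun η hη hs => ?_⟩
  have hs' : HasCompactSupport (Complex.ofRealCLM ∘ η) := hs.comp_left rfl
  have hη' : ContDiff ℝ ∞ (Complex.ofRealCLM ∘ η) := by fun_prop
  have := congrArg (fun T : 𝓢'(Plane, ℂ) => T (hs'.toSchwartzMap hη')) h
  simp only [TemperedDistribution.lineDerivOp_apply_apply, map_neg,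
    Lp.toTemperedDistribution_apply] at this
  rw [eq_comm, neg_eq_iff_eq_neg, eq_comm] at this
  rw [eq_comm]
  convert this using 1
  · congr 1
    refine integral_congr_ae (ae_of_all _ fun x => ?_)
    simp [mul_comm]
  · refine integral_congr_ae (ae_of_all _ fun x => ?_)
    simp only [SchwartzMap.lineDerivOp_apply_eq_fderiv, smul_eq_mul]
    rw [mul_comm]
    congr 1
    have hd : DifferentiableAt ℝ η x := (hη.differentiable (by simp)).differentiableAt
    change _ = fderiv ℝ (Complex.ofRealCLM ∘ η) x (basisVec i)
    rw [(Complex.ofRealCLM.hasFDerivAt.comp x hd.hasFDerivAt).fderiv]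
    simp

theorem fourierMultiplierCLM_derivSymbol (i : Fin 2) (f : 𝓢'(Plane, ℂ)) :
    fourierMultiplierCLM ℂ (derivSymbol i) f = ∂_{basisVec i} f := by
  rw [lineDeriv_eq_fourierMultiplierCLM]
  have : derivSymbol i = (2 * Real.pi * Complex.I) •
    (fun x : Plane => ((inner ℝ x (basisVec i) : ℝ) : ℂ)) := by ext; simp [derivSymbol]
  rw [this, fourierMultiplierCLM_smul (by fun_prop)]
  rfl

theorem hasWeakDeriv_embH (i : Fin 2) (u : L2) : HasWeakDeriv i (embH u) (derH i u) := by
  have h1 := derivSymbol_hasTemperateGrowth i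
  have h2 := besselSymbol_hasTemperateGrowth (-2)
  apply hasWeakDeriv_of_lineDeriv
  rw [derH, embH, fmul_toTemperedDistribution (h1.mul h2), fmul_toTemperedDistribution h2,
    ← fourierMultiplierCLM_derivSymbol, fourierMultiplierCLM_fourierMultiplierCLM_apply h2 h1,
    mul_comm]

theorem hasWeakDeriv_derH (i : Fin 2) (u : L2) : HasWeakDeriv i (derH i u) (derH₂ i u) := by
  have h1 := derivSymbol_hasTemperateGrowth i
  have h2 := besselSymbol_hasTemperateGrowth (-2)
  apply hasWeakDeriv_of_lineDeriv
  rw [derH₂, derH, fmul_toTemperedDistribution (h1.mul (h1.mul h2)),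
    fmul_toTemperedDistribution (h1.mul h2),
    ← fourierMultiplierCLM_derivSymbol,
    fourierMultiplierCLM_fourierMultiplierCLM_apply (h1.mul h2) h1, mul_comm (derivSymbol i)]

theorem norm_Linf_le {f : Linf} {C : ℝ} (hC : 0 ≤ C) (h : ∀ᵐ x, ‖f x‖ ≤ C) : ‖f‖ ≤ C := by
  rw [Lp.norm_def, eLpNorm_exponent_top]
  exact ENNReal.toReal_le_of_le_ofReal hC (eLpNormEssSup_le_of_ae_bound h)

theorem memLp_two_besselSymbol : MemLp (besselSymbol (-2)) 2 (volume : Measure Plane) := by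
  refine ⟨(besselSymbol_hasTemperateGrowth _).1.continuous.aestronglyMeasurable, ?_⟩
  rw [eLpNorm_lt_top_iff_lintegral_rpow_enorm_lt_top (by norm_num) (by norm_num)]
  have h := (integrable_rpow_neg_one_add_norm_sq (E := Plane) (μ := volume) (r := 4)
    (by simp; norm_num)).lintegral_lt_top
  refine lt_of_le_of_lt (le_of_eq ?_) h
  refine lintegral_congr fun x => ?_
  rw [← ofReal_norm, norm_besselSymbol_neg_two,
    ENNReal.ofReal_rpow_of_nonneg (by positivity) (by norm_num)]
  congr 1
  rw [show (-4 / 2 : ℝ) = -2 by norm_num, Real.rpow_neg (by positivity)]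
  simp

/-- The Sobolev inequality `H² ⊆ L^∞` on Schwartz functions: by Fourier inversion and
Cauchy–Schwarz, since `(1 + |ξ|²)⁻¹` is square integrable on the plane. -/
theorem norm_bessel_apply_le (f : 𝓢(Plane, ℂ)) (x : Plane) :
    ‖SchwartzMap.fourierMultiplierCLM ℂ (besselSymbol (-2)) f x‖ ≤
      (eLpNorm (besselSymbol (-2)) 2 (volume : Measure Plane)).toReal *
        ‖f.toLp 2 (volume : Measure Plane)‖ := by
  have hg := besselSymbol_hasTemperateGrowth (-2)
  rw [SchwartzMap.fourierMultiplierCLM_apply, SchwartzMap.fourierInv_coe, Real.fourierInv_eq]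
  refine (norm_integral_le_integral_norm _).trans ?_
  have h0 : (fun v => ‖Real.fourierChar (inner ℝ v x) •
      (SchwartzMap.smulLeftCLM ℂ (besselSymbol (-2)) (𝓕 f)) v‖) =
      fun v => ‖(besselSymbol (-2) • (𝓕 f : 𝓢(Plane, ℂ)) : Plane → ℂ) v‖ := by
    ext v
    rw [Circle.norm_smul, SchwartzMap.smulLeftCLM_apply_apply hg]; rfl
  rw [h0]
  have hm := memLp_two_besselSymbol
  have hF : MemLp (𝓕 f : 𝓢(Plane, ℂ)) 2 (volume : Measure Plane) := SchwartzMap.memLp _ _ _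
  have h1 : eLpNorm (besselSymbol (-2) • (𝓕 f : 𝓢(Plane, ℂ)) : Plane → ℂ) 1 volume ≤
      eLpNorm (besselSymbol (-2)) 2 volume * eLpNorm (𝓕 f : 𝓢(Plane, ℂ)) 2 volume :=
    eLpNorm_smul_le_mul_eLpNorm hF.1 hm.1
  rw [integral_norm_eq_lintegral_enorm (hm.1.smul hF.1), ← eLpNorm_one_eq_lintegral_enorm]
  refine (ENNReal.toReal_mono (ENNReal.mul_ne_top hm.2.ne hF.2.ne) h1).trans_eq ?_
  rw [ENNReal.toReal_mul, ← SchwartzMap.norm_fourier_toL2_eq f, SchwartzMap.norm_toLp]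

/-- The Sobolev embedding `H²(ℝ²) → L^∞(ℝ²)`, where `H²` is identified with `L²` as in `embH`. -/
noncomputable def supH : L2 →L[ℂ] Linf :=
  ((SchwartzMap.toLpCLM ℂ ℂ ⊤ (volume : Measure Plane)).toLinearMap ∘ₗ
    (SchwartzMap.fourierMultiplierCLM ℂ (besselSymbol (-2))).toLinearMap).extendOfNorm
    (SchwartzMap.toLpCLM ℂ ℂ 2 (volume : Measure Plane)).toLinearMap

theorem supH_toLp (f : 𝓢(Plane, ℂ)) :
    supH (f.toLp 2) = (SchwartzMap.fourierMultiplierCLM ℂ (besselSymbol (-2)) f).toLp ⊤ := by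
  have h := SchwartzMap.denseRange_toLpCLM (E := Plane) (F := ℂ) (p := 2)
    (μ := (volume : Measure Plane)) ENNReal.ofNat_ne_top
  refine LinearMap.extendOfNorm_eq
    (f := (SchwartzMap.toLpCLM ℂ ℂ ⊤ (volume : Measure Plane)).toLinearMap ∘ₗ
      (SchwartzMap.fourierMultiplierCLM ℂ (besselSymbol (-2))).toLinearMap)
    (e := (SchwartzMap.toLpCLM ℂ ℂ 2 (volume : Measure Plane)).toLinearMap) h
    ⟨(eLpNorm (besselSymbol (-2)) 2 (volume : Measure Plane)).toReal, fun f => ?_⟩ f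
  change ‖(SchwartzMap.fourierMultiplierCLM ℂ (besselSymbol (-2)) f).toLp ⊤ volume‖ ≤ _
  refine norm_Linf_le (by positivity) ?_
  filter_upwards [SchwartzMap.coeFn_toLp
    (SchwartzMap.fourierMultiplierCLM ℂ (besselSymbol (-2)) f) ⊤ volume] with x hx
  rw [hx]
  exact norm_bessel_apply_le f x

theorem supH_modelS (f : 𝓢(Plane, ℂ)) : supH (modelS f) = f.toLp ⊤ := by
  rw [modelS, supH_toLp, schwartz_bessel_bessel]

theorem supH_ae_eq (u : L2) : supH u =ᵐ[volume] embH u := by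
  have h : (supH u : 𝓢'(Plane, ℂ)) = (embH u : 𝓢'(Plane, ℂ)) := by
    refine denseRange_modelS.induction_on
      (p := fun u => (supH u : 𝓢'(Plane, ℂ)) = (embH u : 𝓢'(Plane, ℂ))) u ?_ ?_
    · exact isClosed_eq
        ((Lp.toTemperedDistributionCLM ℂ volume ⊤).continuous.comp supH.continuous)
        ((Lp.toTemperedDistributionCLM ℂ volume 2).continuous.comp embH.continuous)
    · intro f
      rw [supH_modelS, embH_modelS, Lp.toTemperedDistribution_toLp_eq,
        Lp.toTemperedDistribution_toLp_eq]
  refine ae_eq_of_integral_contDiff_smul_eq ((Lp.memLp _).locallyIntegrable (by simp))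
    ((Lp.memLp _).locallyIntegrable (by norm_num)) fun η hη hs => ?_
  have hs' : HasCompactSupport (Complex.ofRealCLM ∘ η) := hs.comp_left rfl
  have hη' : ContDiff ℝ ∞ (Complex.ofRealCLM ∘ η) := by fun_prop
  have := congrArg (fun T : 𝓢'(Plane, ℂ) => T (hs'.toSchwartzMap hη')) h
  simpa using this

theorem embH_injective : Function.Injective embH := by
  intro u v h
  have hb := besselSymbol_hasTemperateGrowth (-2)
  have h2 : (besselPotential Plane ℂ (-2) (u : 𝓢'(Plane, ℂ))) =
      besselPotential Plane ℂ (-2) (v : 𝓢'(Plane, ℂ)) := by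
    have := congrArg (fun w : L2 => (w : 𝓢'(Plane, ℂ))) h
    simpa only [embH, fmul_toTemperedDistribution hb] using! this
  apply toTemperedDistribution_injective
  rw [TemperedDistribution.besselPotential_neg_apply_eq_iff,
    TemperedDistribution.besselPotential_besselPotential_apply] at h2
  simpa using h2.symm

/-- The infimum in the definition of `sobNorm` runs over at most one function. -/
theorem exists_of_sobNorm_lt_top {s : ℝ} {f : Plane → ℂ} (h : sobNorm s f < ⊤) :
    ∃ (hf : MemLp f 2 (volume : Measure Plane)) (g : L2),
      besselPotential Plane ℂ s ((hf.toLp f : L2) : 𝓢'(Plane, ℂ)) = g ∧ ‖g‖ₑ = sobNorm s f := by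
  have h' := h
  simp only [sobNorm, iInf_lt_iff] at h'
  obtain ⟨g, ⟨hf, hg⟩, -⟩ := h'
  refine ⟨hf, g, hg, le_antisymm ?_ ?_⟩
  · refine le_iInf₂ fun g' hg' => ?_
    obtain ⟨_, hg'⟩ := hg'
    have : g = g' := toTemperedDistribution_injective (hg.symm.trans hg')
    rw [this]
  · exact iInf₂_le g ⟨hf, hg⟩

theorem norm_toLp_besselSymbol_le {σ : ℝ} (hσ : σ ≤ 0) :
    ‖(memLp_besselSymbol hσ).toLp _‖ ≤ 1 := by
  refine norm_Linf_le zero_le_one ?_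
  filter_upwards [(memLp_besselSymbol hσ).coeFn_toLp] with x hx
  rw [hx]
  exact norm_besselSymbol_le_one hσ x

/-- A function in `H^s` with `2 ≤ s` comes from the model of `H²`, with control of the norm. -/
theorem exists_embH_of_sobNorm {s : ℝ} (hs : 2 ≤ s) {f : Plane → ℂ} (h : sobNorm s f < ⊤) :
    ∃ u : L2, embH u =ᵐ[volume] f ∧ ‖u‖ₑ ≤ sobNorm s f := by
  obtain ⟨hf, g, hg, hn⟩ := exists_of_sobNorm_lt_top h
  have h2 : 2 - s ≤ 0 := by linarith
  refine ⟨fmul ((memLp_besselSymbol h2).toLp _) g, ?_, ?_⟩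
  · have : embH (fmul ((memLp_besselSymbol h2).toLp _) g) = hf.toLp f := by
      apply toTemperedDistribution_injective
      simp only [embH]
      rw [fmul_toTemperedDistribution (besselSymbol_hasTemperateGrowth _),
        fmul_toTemperedDistribution (besselSymbol_hasTemperateGrowth _), ← hg]
      change besselPotential Plane ℂ (-2) (besselPotential Plane ℂ (2 - s) _) = _
      rw [TemperedDistribution.besselPotential_besselPotential_apply,
        TemperedDistribution.besselPotential_besselPotential_apply,
        show s + (2 - s + -2) = 0 by ring]
      simp
    rw [this]
    exact hf.coeFn_toLp
  · rw [← hn, ← ofReal_norm, ← ofReal_norm]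
    apply ENNReal.ofReal_le_ofReal
    refine (norm_fmul_le _ _).trans ?_
    exact mul_le_of_le_one_left (norm_nonneg _) (norm_toLp_besselSymbol_le h2)

theorem eLpNorm_le_sobNorm {s : ℝ} (hs : 0 ≤ s) {f : Plane → ℂ} (h : sobNorm s f < ⊤) :
    MemLp f 2 volume ∧ eLpNorm f 2 volume ≤ sobNorm s f := by
  obtain ⟨hf, g, hg, hn⟩ := exists_of_sobNorm_lt_top h
  have h2 : - s ≤ 0 := by linarith
  refine ⟨hf, ?_⟩
  have : fmul ((memLp_besselSymbol h2).toLp _) g = hf.toLp f := by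
    apply toTemperedDistribution_injective
    simp only
    rw [fmul_toTemperedDistribution (besselSymbol_hasTemperateGrowth _), ← hg]
    change besselPotential Plane ℂ (-s) _ = _
    rw [TemperedDistribution.besselPotential_besselPotential_apply]
    simp
  rw [← Lp.enorm_toLp hf, ← this, ← hn, ← ofReal_norm, ← ofReal_norm]
  apply ENNReal.ofReal_le_ofReal
  refine (norm_fmul_le _ _).trans ?_
  exact mul_le_of_le_one_left (norm_nonneg _) (norm_toLp_besselSymbol_le h2)

/-! ### Representatives of amplitudes and phase gradients -/

/-- Weak derivatives are unique up to null sets. -/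
theorem HasWeakDeriv.unique {i : Fin 2} {f f' g g' : Plane → ℂ} (h : HasWeakDeriv i f g)
    (h' : HasWeakDeriv i f' g') (hf : f =ᵐ[volume] f') : g =ᵐ[volume] g' := by
  refine ae_eq_of_integral_contDiff_smul_eq h.2.1 h'.2.1 fun η hη hs => ?_
  have h1 := h.2.2 η hη hs
  have h2 := h'.2.2 η hη hs
  have h3 : ∫ x, f x * (fderiv ℝ η x (basisVec i) : ℂ) =
      ∫ x, f' x * (fderiv ℝ η x (basisVec i) : ℂ) :=
    integral_congr_ae (hf.mono fun x hx => by simp only [hx])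
  rw [h1, h2, neg_inj] at h3
  simpa [mul_comm] using h3

theorem HasWeakDeriv.congr {i : Fin 2} {f f' g g' : Plane → ℂ} (h : HasWeakDeriv i f g)
    (hf : f =ᵐ[volume] f') (hg : g =ᵐ[volume] g') : HasWeakDeriv i f' g' := by
  refine ⟨h.1.congr hf, h.2.1.congr hg, fun η hη hs => ?_⟩
  rw [← integral_congr_ae (hf.mono fun x hx => by simp only [hx] :
      (fun x => f x * (fderiv ℝ η x (basisVec i) : ℂ)) =ᵐ[volume]
      (fun x => f' x * (fderiv ℝ η x (basisVec i) : ℂ))), h.2.2 η hη hs,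
    integral_congr_ae (hg.mono fun x hx => by simp only [hx] :
      (fun x => g x * (η x : ℂ)) =ᵐ[volume] (fun x => g' x * (η x : ℂ)))]

theorem integrable_mul_test {f : Plane → ℂ} (hf : LocallyIntegrable f volume) {η : Plane → ℝ}
    (hη : Continuous η) (hs : HasCompactSupport η) : Integrable (fun x => f x * (η x : ℂ)) := by
  have := hf.integrable_smul_left_of_hasCompactSupport hη hs
  simpa [mul_comm] using this

theorem continuous_partial {η : Plane → ℝ} (hη : ContDiff ℝ ∞ η) (i : Fin 2) :
    Continuous fun x => fderiv ℝ η x (basisVec i) :=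
  (hη.continuous_fderiv (by simp)).clm_apply continuous_const

theorem hasCompactSupport_partial {η : Plane → ℝ} (hs : HasCompactSupport η) (i : Fin 2) :
    HasCompactSupport fun x => fderiv ℝ η x (basisVec i) :=
  hs.fderiv_apply (𝕜 := ℝ) (basisVec i)

theorem HasWeakDeriv.add {i : Fin 2} {f f' g g' : Plane → ℂ} (h : HasWeakDeriv i f g)
    (h' : HasWeakDeriv i f' g') : HasWeakDeriv i (f + f') (g + g') := by
  refine ⟨h.1.add h'.1, h.2.1.add h'.2.1, fun η hη hs => ?_⟩
  have c1 := continuous_partial hη i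
  have c2 := hasCompactSupport_partial hs i
  simp only [Pi.add_apply, add_mul]
  rw [integral_add (integrable_mul_test h.1 c1 c2) (integrable_mul_test h'.1 c1 c2),
    integral_add (integrable_mul_test h.2.1 hη.continuous hs)
      (integrable_mul_test h'.2.1 hη.continuous hs), h.2.2 η hη hs, h'.2.2 η hη hs, neg_add]

theorem HasWeakDeriv.const_smul {i : Fin 2} {f g : Plane → ℂ} (h : HasWeakDeriv i f g) (c : ℂ) :
    HasWeakDeriv i (c • f) (c • g) := by
  refine ⟨h.1.smul c, h.2.1.smul c, fun η hη hs => ?_⟩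
  simp only [Pi.smul_apply, smul_eq_mul, mul_assoc, integral_const_mul]
  rw [h.2.2 η hη hs, mul_neg]

/-- `f ∈ H²(ℝ²)` is represented by `u` in the model of `H²` given by `embH`. -/
def RepH (f : Plane → ℂ) (u : L2) : Prop := embH u =ᵐ[volume] f

theorem RepH.unique {f f' : Plane → ℂ} {u v : L2} (h : RepH f u) (h' : RepH f' v)
    (hf : f =ᵐ[volume] f') : u = v :=
  embH_injective (Lp.ext (h.trans (hf.trans h'.symm)))

theorem RepH.add {f g : Plane → ℂ} {u v : L2} (hu : RepH f u) (hv : RepH g v) :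
    RepH (f + g) (u + v) := by
  unfold RepH
  rw [map_add]
  exact (Lp.coeFn_add _ _).trans (Filter.EventuallyEq.add hu hv)

theorem RepH.const_smul {f : Plane → ℂ} {u : L2} (hu : RepH f u) (c : ℂ) :
    RepH (c • f) (c • u) := by
  unfold RepH
  rw [map_smul]
  exact (Lp.coeFn_smul _ _).trans (Filter.EventuallyEq.const_smul hu c)

theorem RepH.zero : RepH 0 0 := by
  unfold RepH
  rw [map_zero]
  exact Lp.coeFn_zero _ _ _

/-- A pair `X = (V, r) ∈ L^∞ × L²` represents `f` together with its derivative `∂ᵢ f`. -/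
def RepField (i : Fin 2) (f : Plane → ℂ) (X : Linf × L2) : Prop :=
  X.1 =ᵐ[volume] f ∧ HasWeakDeriv i f X.2

theorem RepField.add {i : Fin 2} {f g : Plane → ℂ} {X Y : Linf × L2} (hX : RepField i f X)
    (hY : RepField i g Y) : RepField i (f + g) (X + Y) :=
  ⟨(Lp.coeFn_add _ _).trans (hX.1.add hY.1),
    (hX.2.add hY.2).congr (ae_eq_refl _) (Lp.coeFn_add X.2 Y.2).symm⟩

theorem RepField.const_smul {i : Fin 2} {f : Plane → ℂ} {X : Linf × L2} (hX : RepField i f X)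
    (c : ℂ) : RepField i (c • f) (c • X) :=
  ⟨(Lp.coeFn_smul _ _).trans (hX.1.const_smul c),
    (hX.2.const_smul c).congr (ae_eq_refl _) (Lp.coeFn_smul c X.2).symm⟩

theorem RepField.zero (i : Fin 2) : RepField i 0 0 := by
  refine ⟨Lp.coeFn_zero _ _ _, HasWeakDeriv.congr (g := 0) ⟨?_, ?_, ?_⟩ (ae_eq_refl _)
    (Lp.coeFn_zero _ _ _).symm⟩
  · exact locallyIntegrable_zero
  · exact locallyIntegrable_zero
  · intro η _ _; simp

theorem RepH.sub_sum {f : Plane → ℂ} {u : L2} (hf : RepH f u) (s : Finset ℕ) (z : ℕ → ℂ)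
    {F : ℕ → Plane → ℂ} {U : ℕ → L2} (hF : ∀ j ∈ s, RepH (F j) (U j)) :
    RepH (f - ∑ j ∈ s, z j • F j) (u - ∑ j ∈ s, z j • U j) := by
  have hs : RepH (∑ j ∈ s, z j • F j) (∑ j ∈ s, z j • U j) := by
    induction s using Finset.induction_on with
    | empty => exact RepH.zero
    | insert k s hk ih =>
      rw [Finset.sum_insert hk, Finset.sum_insert hk]
      exact ((hF k (Finset.mem_insert_self k s)).const_smul _).add
        (ih fun j hj => hF j (Finset.mem_insert_of_mem hj))
  simpa [sub_eq_add_neg] using hf.add (hs.const_smul (-1))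

theorem RepField.sub_sum {i : Fin 2} {f : Plane → ℂ} {u : Linf × L2} (hf : RepField i f u)
    (s : Finset ℕ) (z : ℕ → ℂ) {F : ℕ → Plane → ℂ} {U : ℕ → Linf × L2}
    (hF : ∀ j ∈ s, RepField i (F j) (U j)) :
    RepField i (f - ∑ j ∈ s, z j • F j) (u - ∑ j ∈ s, z j • U j) := by
  have hs : RepField i (∑ j ∈ s, z j • F j) (∑ j ∈ s, z j • U j) := by
    induction s using Finset.induction_on with
    | empty => exact RepField.zero i
    | insert k s hk ih =>
      rw [Finset.sum_insert hk, Finset.sum_insert hk]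
      exact ((hF k (Finset.mem_insert_self k s)).const_smul _).add
        (ih fun j hj => hF j (Finset.mem_insert_of_mem hj))
  simpa [sub_eq_add_neg] using hf.add (hs.const_smul (-1))

theorem RepH.enorm_le {f : Plane → ℂ} {u : L2} (h : RepH f u) {s : ℝ} (hs : 2 ≤ s) :
    ‖u‖ₑ ≤ sobNorm s f := by
  rcases eq_or_ne (sobNorm s f) ⊤ with ht | ht
  · rw [ht]; exact le_top
  · obtain ⟨v, hv, hn⟩ := exists_embH_of_sobNorm hs (lt_top_iff_ne_top.2 ht)
    rwa [h.unique hv (ae_eq_refl f)]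

theorem exists_repField {σ q : ℝ} (hσ : 1 ≤ σ) {V : Fin 2 → Plane → ℂ} (h : fieldNorm σ q V < ⊤)
    (i : Fin 2) : ∃ X, RepField i (V i) X := by
  have h1 : zhidkovNorm σ (V i) < ⊤ := by
    refine lt_of_le_of_lt ?_ h
    refine le_self_add.trans (Finset.single_le_sum
      (f := fun i => zhidkovNorm σ (V i) + eLpNorm (V i) (ENNReal.ofReal q) volume)
      (fun _ _ => bot_le) (Finset.mem_univ i))
  have h2 : eLpNorm (V i) ⊤ volume < ⊤ := lt_of_le_of_lt le_self_add h1
  have h3 : ⨅ (g : Plane → ℂ) (_ : HasWeakDeriv i (V i) g), sobNorm (σ - 1) g < ⊤ := by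
    refine lt_of_le_of_lt ?_ h1
    exact (Finset.single_le_sum
      (f := fun l => ⨅ (g : Plane → ℂ) (_ : HasWeakDeriv l (V i) g), sobNorm (σ - 1) g)
      (fun _ _ => bot_le) (Finset.mem_univ i)).trans le_add_self
  simp only [iInf_lt_iff] at h3
  obtain ⟨g, hg, hgn⟩ := h3
  obtain ⟨hg2, -⟩ := eLpNorm_le_sobNorm (by linarith) hgn
  have hV : MemLp (V i) ⊤ volume := ⟨hg.1.aestronglyMeasurable, h2⟩
  exact ⟨(hV.toLp _, hg2.toLp _), hV.coeFn_toLp, hg.congr (ae_eq_refl _) hg2.coeFn_toLp.symm⟩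

/-- The norm of `L^∞ × L²` is dominated by the norm of `X^σ ∩ L^q`, whatever `q` is. -/
theorem RepField.enorm_le {i : Fin 2} {V : Fin 2 → Plane → ℂ} {X : Linf × L2}
    (hX : RepField i (V i) X) {σ : ℝ} (hσ : 1 ≤ σ) (q : ℝ) : ‖X‖ₑ ≤ fieldNorm σ q V := by
  have h1 : zhidkovNorm σ (V i) ≤ fieldNorm σ q V :=
    le_self_add.trans (Finset.single_le_sum
      (f := fun i => zhidkovNorm σ (V i) + eLpNorm (V i) (ENNReal.ofReal q) volume)
      (fun _ _ => bot_le) (Finset.mem_univ i))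
  refine le_trans ?_ h1
  have e1 : ‖X.1‖ₑ ≤ zhidkovNorm σ (V i) := by
    refine le_trans (le_of_eq ?_) le_self_add
    rw [Lp.enorm_def]
    exact eLpNorm_congr_ae hX.1
  have e2 : ‖X.2‖ₑ ≤ zhidkovNorm σ (V i) := by
    refine le_trans ?_ ((Finset.single_le_sum
      (f := fun l => ⨅ (g : Plane → ℂ) (_ : HasWeakDeriv l (V i) g), sobNorm (σ - 1) g)
      (fun _ _ => bot_le) (Finset.mem_univ i)).trans le_add_self)
    refine le_iInf₂ fun g hg => ?_
    rcases eq_or_ne (sobNorm (σ - 1) g) ⊤ with ht | ht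
    · rw [ht]; exact le_top
    · refine le_trans (le_of_eq ?_)
        (eLpNorm_le_sobNorm (by linarith) (lt_top_iff_ne_top.2 ht)).2
      rw [Lp.enorm_def]
      exact eLpNorm_congr_ae (hX.2.unique hg (ae_eq_refl _))
  rw [← ofReal_norm, Prod.norm_def]
  rcases max_choice ‖X.1‖ ‖X.2‖ with h | h <;> rw [h, ofReal_norm] <;> assumption

/-! ### Integration by parts with test functions -/

/-- The definition of weak derivatives, extended from real to complex test functions. -/
theorem HasWeakDeriv.integral_complex_test {i : Fin 2} {f g : Plane → ℂ} (h : HasWeakDeriv i f g)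
    {η : Plane → ℂ} (hη : ContDiff ℝ ∞ η) (hs : HasCompactSupport η) :
    ∫ x, f x * fderiv ℝ η x (basisVec i) = -∫ x, g x * η x := by
  have hre : ContDiff ℝ ∞ (fun x => (η x).re) := Complex.reCLM.contDiff.comp hη
  have him : ContDiff ℝ ∞ (fun x => (η x).im) := Complex.imCLM.contDiff.comp hη
  have sre : HasCompactSupport (fun x => (η x).re) := hs.comp_left (g := Complex.re) rfl
  have sim : HasCompactSupport (fun x => (η x).im) := hs.comp_left (g := Complex.im) rfl
  have hd : ∀ x, fderiv ℝ η x (basisVec i) =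
      (fderiv ℝ (fun x => (η x).re) x (basisVec i) : ℂ) +
        Complex.I * (fderiv ℝ (fun x => (η x).im) x (basisVec i) : ℂ) := by
    intro x
    have hx := (hη.differentiable (by simp) x).hasFDerivAt
    have h1 : HasFDerivAt (fun x => (η x).re) (Complex.reCLM ∘L fderiv ℝ η x) x :=
      Complex.reCLM.hasFDerivAt.comp x hx
    have h2 : HasFDerivAt (fun x => (η x).im) (Complex.imCLM ∘L fderiv ℝ η x) x :=
      Complex.imCLM.hasFDerivAt.comp x hx
    rw [h1.fderiv, h2.fderiv]
    simp [mul_comm Complex.I, Complex.re_add_im]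
  have c1 := continuous_partial hre i
  have c2 := hasCompactSupport_partial sre i
  have c3 := continuous_partial him i
  have c4 := hasCompactSupport_partial sim i
  have e1 : ∫ x, f x * fderiv ℝ η x (basisVec i) =
      (∫ x, f x * (fderiv ℝ (fun x => (η x).re) x (basisVec i) : ℂ)) +
        Complex.I * ∫ x, f x * (fderiv ℝ (fun x => (η x).im) x (basisVec i) : ℂ) := by
    rw [← integral_const_mul, ← integral_add (integrable_mul_test h.1 c1 c2)
      ((integrable_mul_test h.1 c3 c4).const_mul _)]
    refine integral_congr_ae (ae_of_all _ fun x => ?_)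
    simp only [hd x]; ring
  have e2 : ∫ x, g x * η x = (∫ x, g x * ((η x).re : ℂ)) +
      Complex.I * ∫ x, g x * ((η x).im : ℂ) := by
    rw [← integral_const_mul, ← integral_add (integrable_mul_test h.2.1 hre.continuous sre)
      ((integrable_mul_test h.2.1 him.continuous sim).const_mul _)]
    refine integral_congr_ae (ae_of_all _ fun x => ?_)
    simp only
    conv_lhs => rw [← Complex.re_add_im (η x)]
    ring
  rw [e1, e2, h.2.2 _ hre sre, h.2.2 _ him sim]
  ring

/-- A real test function on `ℝ²`. -/
structure TestFun where
  /-- The underlying function. -/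
  fn : Plane → ℝ
  smooth : ContDiff ℝ ∞ fn
  compact : HasCompactSupport fn

/-- A real test function as a complex Schwartz function. -/
noncomputable def TestFun.toS (w : TestFun) : 𝓢(Plane, ℂ) :=
  HasCompactSupport.toSchwartzMap (f := Complex.ofRealCLM ∘ w.fn)
    (w.compact.comp_left (map_zero _)) (Complex.ofRealCLM.contDiff.comp w.smooth)

theorem TestFun.toS_apply (w : TestFun) (x : Plane) : w.toS x = (w.fn x : ℂ) := rfl

theorem TestFun.hasCompactSupport_toS (w : TestFun) : HasCompactSupport w.toS :=
  w.compact.comp_left (g := Complex.ofRealCLM) (map_zero _)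

theorem TestFun.lineDeriv_toS (w : TestFun) (i : Fin 2) (x : Plane) :
    (∂_{basisVec i} w.toS : 𝓢(Plane, ℂ)) x = (fderiv ℝ w.fn x (basisVec i) : ℂ) := by
  rw [SchwartzMap.lineDerivOp_apply_eq_fderiv]
  have hd : DifferentiableAt ℝ w.fn x := (w.smooth.differentiable (by simp)).differentiableAt
  change fderiv ℝ (Complex.ofRealCLM ∘ w.fn) x (basisVec i) = _
  rw [(Complex.ofRealCLM.hasFDerivAt.comp x hd.hasFDerivAt).fderiv]
  simp

/-- A real test function as an element of `L^∞`. -/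
noncomputable def TestFun.val (w : TestFun) : Linf := w.toS.toLp ⊤

/-- The partial derivative of a real test function as an element of `L^∞`. -/
noncomputable def TestFun.der (w : TestFun) (i : Fin 2) : Linf :=
  (∂_{basisVec i} w.toS : 𝓢(Plane, ℂ)).toLp ⊤

theorem TestFun.val_ae (w : TestFun) : w.val =ᵐ[volume] fun x => (w.fn x : ℂ) :=
  SchwartzMap.coeFn_toLp _ _ _

theorem TestFun.der_ae (w : TestFun) (i : Fin 2) :
    w.der i =ᵐ[volume] fun x => (fderiv ℝ w.fn x (basisVec i) : ℂ) := by
  filter_upwards [SchwartzMap.coeFn_toLp (∂_{basisVec i} w.toS : 𝓢(Plane, ℂ)) ⊤ volume] with x hx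
  rw [TestFun.der, hx, w.lineDeriv_toS]

theorem inner_mulL (g : L2) (V : Linf) (f : L2) :
    ⟪g, mulL V f⟫_ℂ = ∫ x, V x * f x * (starRingEnd ℂ) (g x) := by
  rw [L2.inner_def]
  refine integral_congr_ae ?_
  filter_upwards [coeFn_mulL V f] with x hx
  rw [hx]; rfl

theorem integrable_inner_mulL (g : L2) (V : Linf) (f : L2) :
    Integrable (fun x => V x * f x * (starRingEnd ℂ) (g x)) := by
  refine (L2.integrable_inner (𝕜 := ℂ) g (mulL V f)).congr ?_
  filter_upwards [coeFn_mulL V f] with x hx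
  rw [hx]; rfl

/-- Integration by parts of a weakly differentiable `L²` function against a Schwartz function
localized by a test function. -/
theorem HasWeakDeriv.inner_schwartz {i : Fin 2} {F G : L2} (h : HasWeakDeriv i F G) (w : TestFun)
    (g : 𝓢(Plane, ℂ)) :
    ⟪g.toLp 2, mulL w.val G⟫_ℂ = -⟪(∂_{basisVec i} g : 𝓢(Plane, ℂ)).toLp 2, mulL w.val F⟫_ℂ -
      ⟪g.toLp 2, mulL (w.der i) F⟫_ℂ := by
  have hconj : ContDiff ℝ ∞ (fun x => (starRingEnd ℂ) (g x)) :=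
    Complex.conjCLE.contDiff.comp (g.smooth ⊤)
  have hη : ContDiff ℝ ∞ (fun x => w.toS x * (starRingEnd ℂ) (g x)) := (w.toS.smooth ⊤).mul hconj
  have hs : HasCompactSupport (fun x => w.toS x * (starRingEnd ℂ) (g x)) :=
    w.hasCompactSupport_toS.mul_right
  have key := h.integral_complex_test hη hs
  have hd : ∀ x, fderiv ℝ (fun x => w.toS x * (starRingEnd ℂ) (g x)) x (basisVec i) =
      (w.fn x : ℂ) * (starRingEnd ℂ) ((∂_{basisVec i} g : 𝓢(Plane, ℂ)) x) +
      (fderiv ℝ w.fn x (basisVec i) : ℂ) * (starRingEnd ℂ) (g x) := by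
    intro x
    have h1 : HasFDerivAt (fun x => (starRingEnd ℂ) (g x))
        ((Complex.conjCLE : ℂ →L[ℝ] ℂ) ∘L fderiv ℝ g x) x :=
      (Complex.conjCLE : ℂ →L[ℝ] ℂ).hasFDerivAt.comp x (g.hasFDerivAt x)
    rw [((w.toS.hasFDerivAt x).fun_mul h1).fderiv, ← w.lineDeriv_toS,
      SchwartzMap.lineDerivOp_apply_eq_fderiv, SchwartzMap.lineDerivOp_apply_eq_fderiv]
    simp [TestFun.toS_apply, mul_comm]
  have hg := SchwartzMap.coeFn_toLp g 2 volume
  have hdg := SchwartzMap.coeFn_toLp (∂_{basisVec i} g : 𝓢(Plane, ℂ)) 2 volume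
  have e1 : ⟪g.toLp 2, mulL w.val G⟫_ℂ = ∫ x, G x * (w.toS x * (starRingEnd ℂ) (g x)) := by
    rw [inner_mulL]
    refine integral_congr_ae ?_
    filter_upwards [hg, w.val_ae] with x h1 h2
    rw [h1, h2, w.toS_apply]; ring
  have e2 : ⟪(∂_{basisVec i} g : 𝓢(Plane, ℂ)).toLp 2, mulL w.val F⟫_ℂ +
      ⟪g.toLp 2, mulL (w.der i) F⟫_ℂ = ∫ x, F x *
        fderiv ℝ (fun x => w.toS x * (starRingEnd ℂ) (g x)) x (basisVec i) := by
    rw [inner_mulL, inner_mulL, ← integral_add (integrable_inner_mulL _ _ _)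
      (integrable_inner_mulL _ _ _)]
    refine integral_congr_ae ?_
    filter_upwards [hg, hdg, w.val_ae, w.der_ae i] with x h1 h2 h3 h4
    rw [h1, h2, h3, h4, hd]; ring
  rw [e1, ← neg_add', e2, key, neg_neg]

/-- A closed condition on `H²` holds everywhere if it holds for Schwartz functions. -/
theorem induction_on_modelS {p : L2 → Prop} (hp : IsClosed {u | p u})
    (h : ∀ f : 𝓢(Plane, ℂ), p (modelS f)) (u : L2) : p u :=
  denseRange_modelS.induction_on u hp h

/-- Integration by parts against an element of `H²`, localized by a test function. -/
theorem HasWeakDeriv.inner_embH {i : Fin 2} {F G : L2} (h : HasWeakDeriv i F G) (w : TestFun)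
    (v : L2) : ⟪embH v, mulL w.val G⟫_ℂ = -⟪derH i v, mulL w.val F⟫_ℂ -
      ⟪embH v, mulL (w.der i) F⟫_ℂ := by
  refine induction_on_modelS (p := fun v => ⟪embH v, mulL w.val G⟫_ℂ =
    -⟪derH i v, mulL w.val F⟫_ℂ - ⟪embH v, mulL (w.der i) F⟫_ℂ) ?_ (fun f => ?_) v
  · exact isClosed_eq (by fun_prop) (by fun_prop)
  · rw [embH_modelS, derH_modelS]
    exact h.inner_schwartz w f

/-- Integration by parts against the derivative of an element of `H²`. -/
theorem HasWeakDeriv.inner_derH {i : Fin 2} {F G : L2} (h : HasWeakDeriv i F G) (w : TestFun)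
    (v : L2) : ⟪derH i v, mulL w.val G⟫_ℂ = -⟪derH₂ i v, mulL w.val F⟫_ℂ -
      ⟪derH i v, mulL (w.der i) F⟫_ℂ := by
  refine induction_on_modelS (p := fun v => ⟪derH i v, mulL w.val G⟫_ℂ =
    -⟪derH₂ i v, mulL w.val F⟫_ℂ - ⟪derH i v, mulL (w.der i) F⟫_ℂ) ?_ (fun f => ?_) v
  · exact isClosed_eq (by fun_prop) (by fun_prop)
  · rw [derH₂_modelS, derH_modelS]
    exact h.inner_schwartz w (∂_{basisVec i} f)

/-- The product rule for a bounded function `V` with weak derivative `r ∈ L²` and an element of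
`H²`. -/
theorem HasWeakDeriv.mulL_embH {i : Fin 2} {V : Linf} {r : L2} (h : HasWeakDeriv i V r) (u : L2) :
    HasWeakDeriv i (mulL V (embH u)) ((mulL V (derH i u) + mulL (supH u) r : L2)) := by
  refine ⟨(Lp.memLp _).locallyIntegrable (by norm_num),
    (Lp.memLp _).locallyIntegrable (by norm_num), fun η hη hs => ?_⟩
  let w : TestFun := ⟨η, hη, hs⟩
  have hw : ∀ F : L2, ∫ x, F x * (η x : ℂ) = ⟪w.toS.toLp 2, F⟫_ℂ := by
    intro F
    rw [L2.inner_def]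
    refine integral_congr_ae ?_
    filter_upwards [SchwartzMap.coeFn_toLp w.toS 2 volume] with x hx
    rw [hx, w.toS_apply, RCLike.inner_apply, Complex.conj_ofReal]
  have hdw : ∀ F : L2, ∫ x, F x * (fderiv ℝ η x (basisVec i) : ℂ) =
      ⟪(∂_{basisVec i} w.toS : 𝓢(Plane, ℂ)).toLp 2, F⟫_ℂ := by
    intro F
    rw [L2.inner_def]
    refine integral_congr_ae ?_
    filter_upwards [SchwartzMap.coeFn_toLp (∂_{basisVec i} w.toS : 𝓢(Plane, ℂ)) 2 volume] with x hx
    rw [hx, w.lineDeriv_toS, RCLike.inner_apply, Complex.conj_ofReal]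
  rw [hw, hdw]
  refine induction_on_modelS (p := fun u =>
    ⟪(∂_{basisVec i} w.toS : 𝓢(Plane, ℂ)).toLp 2, mulL V (embH u)⟫_ℂ =
      -⟪w.toS.toLp 2, mulL V (derH i u) + mulL (supH u) r⟫_ℂ) ?_ (fun f => ?_) u
  · exact isClosed_eq (by fun_prop) (by fun_prop)
  · rw [inner_add_right, ← hw, ← hw, ← hdw, embH_modelS, derH_modelS, supH_modelS]
    have hη : ContDiff ℝ ∞ (fun x => f x * w.toS x) := (f.smooth ⊤).mul (w.toS.smooth ⊤)
    have hs : HasCompactSupport (fun x => f x * w.toS x) := w.hasCompactSupport_toS.mul_left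
    have key := h.integral_complex_test hη hs
    have hd : ∀ x, fderiv ℝ (fun x => f x * w.toS x) x (basisVec i) =
        f x * (fderiv ℝ η x (basisVec i) : ℂ) + (∂_{basisVec i} f : 𝓢(Plane, ℂ)) x * (η x : ℂ) := by
      intro x
      rw [((f.hasFDerivAt x).fun_mul (w.toS.hasFDerivAt x)).fderiv, ← w.lineDeriv_toS,
        SchwartzMap.lineDerivOp_apply_eq_fderiv, SchwartzMap.lineDerivOp_apply_eq_fderiv]
      simp only [add_apply, smul_apply, smul_eq_mul, mul_comm, w.toS_apply]
      rfl
    have hf := SchwartzMap.coeFn_toLp f 2 volume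
    have hf' := SchwartzMap.coeFn_toLp f ⊤ volume
    have hdf := SchwartzMap.coeFn_toLp (∂_{basisVec i} f : 𝓢(Plane, ℂ)) 2 volume
    have e1 : ∫ x, mulL (f.toLp ⊤) r x * (η x : ℂ) = ∫ x, r x * (f x * w.toS x) := by
      refine integral_congr_ae ?_
      filter_upwards [coeFn_mulL (f.toLp ⊤) r, hf'] with x h1 h2
      rw [h1, h2, w.toS_apply]; ring
    let f₂ : L2 := f.toLp 2
    let df₂ : L2 := (∂_{basisVec i} f : 𝓢(Plane, ℂ)).toLp 2
    have hL : ∀ F : L2, LocallyIntegrable F volume :=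
      fun F => (Lp.memLp F).locallyIntegrable (by norm_num)
    have e2 : (∫ x, mulL V f₂ x * (fderiv ℝ η x (basisVec i) : ℂ)) +
        ∫ x, mulL V df₂ x * (η x : ℂ) =
        ∫ x, V x * fderiv ℝ (fun x => f x * w.toS x) x (basisVec i) := by
      have i1 := integrable_mul_test (hL (mulL V f₂)) (continuous_partial w.smooth i)
        (hasCompactSupport_partial w.compact i)
      have i2 := integrable_mul_test
        (hL (mulL V df₂)) w.smooth.continuous w.compact
      refine (integral_add i1 i2).symm.trans ?_
      refine integral_congr_ae ?_
      filter_upwards [coeFn_mulL V f₂, hf, hdf,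
        coeFn_mulL V df₂] with x h1 h2 h3 h4
      rw [h1, h4, show f₂ x = f x from h2, show df₂ x = _ from h3, hd]; ring
    rw [e1]
    rw [key] at e2
    linear_combination e2

/-! ### Energy production of the coefficients -/

/-- The function `V ∈ L^∞` is real-valued. -/
def IsRealLinf (V : Linf) : Prop := ∀ᵐ x, (starRingEnd ℂ) (V x) = V x

theorem TestFun.isReal_val (w : TestFun) : IsRealLinf w.val := by
  filter_upwards [w.val_ae] with x hx
  rw [hx, Complex.conj_ofReal]

theorem mulL_comm (V W : Linf) (f : L2) : mulL V (mulL W f) = mulL W (mulL V f) := by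
  apply Lp.ext
  filter_upwards [coeFn_mulL V (mulL W f), coeFn_mulL W f, coeFn_mulL W (mulL V f),
    coeFn_mulL V f] with x h1 h2 h3 h4
  rw [h1, h2, h3, h4]; ring

theorem IsRealLinf.inner_mulL {V : Linf} (hV : IsRealLinf V) (f g : L2) :
    ⟪mulL V f, g⟫_ℂ = ⟪f, mulL V g⟫_ℂ := by
  rw [L2.inner_def, L2.inner_def]
  refine integral_congr_ae ?_
  filter_upwards [coeFn_mulL V f, coeFn_mulL V g, hV] with x h1 h2 h3
  rw [h1, h2, RCLike.inner_apply, RCLike.inner_apply, map_mul, h3]; ring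

/-- The transport operator `∇φ · ∇a + ½ a Δφ` in one direction, at the level of representatives. -/
noncomputable def transport (i : Fin 2) (X : Linf × L2) (u : L2) : L2 :=
  mulL X.1 (derH i u) + (1 / 2 : ℂ) • mulL (supH u) X.2

theorem norm_star_L2 (f : L2) : ‖star f‖ = ‖f‖ := by
  rw [Lp.norm_def, Lp.norm_def]
  congr 1
  refine eLpNorm_congr_norm_ae ?_
  filter_upwards [Lp.coeFn_star f] with x hx
  rw [hx, Pi.star_apply, norm_star]

/-- The product of two functions in `H²` with one in `L²` is rearranged so that the weight `W`
sits on `u`, while the bounded factor `v` multiplies `r`. -/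
theorem inner_mulL_supH (W : Linf) (u v r : L2) :
    ⟪embH v, mulL W (mulL (supH u) r)⟫_ℂ = ⟪mulL (supH v) (star r), mulL W (embH u)⟫_ℂ := by
  rw [L2.inner_def, L2.inner_def]
  refine integral_congr_ae ?_
  filter_upwards [coeFn_mulL W (mulL (supH u) r), coeFn_mulL (supH u) r,
    coeFn_mulL (supH v) (star r), coeFn_mulL W (embH u), supH_ae_eq u, supH_ae_eq v,
    Lp.coeFn_star r] with x h1 h2 h3 h4 h5 h6 h7
  rw [h1, h2, h3, h4, h5, h6, h7, RCLike.inner_apply, RCLike.inner_apply, map_mul, Pi.star_apply,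
    ← starRingEnd_apply, Complex.conj_conj]
  ring

theorem norm_inner_mulL_le (f g : L2) (V : Linf) : ‖⟪f, mulL V g⟫_ℂ‖ ≤ ‖V‖ * (‖f‖ * ‖g‖) :=
  (norm_inner_le_norm _ _).trans
    ((mul_le_mul_of_nonneg_left (norm_mulL_le V g) (norm_nonneg _)).trans_eq (by ring))

/-- Transport is antisymmetric up to the derivative of the weight: the term `½ a Δφ` cancels the
divergence of `∇φ`. -/
theorem transport_self_eq {i : Fin 2} {X : Linf × L2} (hX : HasWeakDeriv i X.1 X.2)
    (hr : IsRealLinf X.1) (w : TestFun) (u : L2) :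
    2 * (⟪embH u, mulL w.val (transport i X u)⟫_ℂ).re =
      -(⟪embH u, mulL (w.der i) (mulL X.1 (embH u))⟫_ℂ).re := by
  have h := (hX.mulL_embH u).inner_embH w u
  have hs : (⟪derH i u, mulL w.val (mulL X.1 (embH u))⟫_ℂ).re =
      (⟪embH u, mulL w.val (mulL X.1 (derH i u))⟫_ℂ).re := by
    rw [← w.isReal_val.inner_mulL, ← hr.inner_mulL, mulL_comm, ← inner_conj_symm, Complex.conj_re]
  have h' := congrArg Complex.re h
  simp only [map_add, inner_add_right, Complex.add_re, Complex.sub_re, Complex.neg_re] at h'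
  rw [hs] at h'
  have hsm : (⟪embH u, (1 / 2 : ℂ) • mulL w.val (mulL (supH u) X.2)⟫_ℂ).re =
      1 / 2 * (⟪embH u, mulL w.val (mulL (supH u) X.2)⟫_ℂ).re := by
    rw [inner_smul_right]; simp
  simp only [transport, map_add, map_smul, inner_add_right, Complex.add_re, hsm]
  linarith

/-- Transport of `u` tested against `v` with the weight `w`: the derivative is moved from `u` to
`v` and to the weight, so that the weight remains only on `u` itself. -/
theorem norm_transport_le {i : Fin 2} {X : Linf × L2} (hX : HasWeakDeriv i X.1 X.2)
    (w : TestFun) (u v : L2) : ‖⟪embH v, mulL w.val (transport i X u)⟫_ℂ‖ ≤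
      ‖X.1‖ * (‖derH i v‖ * ‖mulL w.val (embH u)‖) +
      ‖w.der i‖ * (‖embH v‖ * (‖X.1‖ * ‖embH u‖)) +
      1 / 2 * (‖supH v‖ * ‖X.2‖ * ‖mulL w.val (embH u)‖) := by
  have h := (hX.mulL_embH u).inner_embH w v
  simp only [map_add, inner_add_right] at h
  have hsm : ⟪embH v, mulL w.val (transport i X u)⟫_ℂ =
      -⟪derH i v, mulL X.1 (mulL w.val (embH u))⟫_ℂ -
      ⟪embH v, mulL (w.der i) (mulL X.1 (embH u))⟫_ℂ -
      (1 / 2 : ℂ) * ⟪mulL (supH v) (star X.2), mulL w.val (embH u)⟫_ℂ := by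
    rw [mulL_comm, ← inner_mulL_supH]
    simp only [transport, map_add, map_smul, inner_add_right]
    rw [inner_smul_right]
    linear_combination h
  rw [hsm]
  refine (norm_sub_le _ _).trans (add_le_add ((norm_sub_le _ _).trans (add_le_add ?_ ?_)) ?_)
  · rw [norm_neg]; exact norm_inner_mulL_le _ _ _
  · refine (norm_inner_mulL_le _ _ _).trans ?_
    gcongr; exact norm_mulL_le _ _
  · rw [norm_mul, show ‖(1 / 2 : ℂ)‖ = 1 / 2 by simp]
    gcongr
    refine (norm_inner_le_norm _ _).trans ?_
    gcongr
    refine (norm_mulL_le _ _).trans_eq ?_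
    rw [norm_star_L2]

/-- Both derivatives of `∂ᵢ² u` are moved to `v` and to the weight. -/
theorem norm_laplace_le (i : Fin 2) (w : TestFun) (u v : L2) :
    ‖⟪embH v, mulL w.val (derH₂ i u)⟫_ℂ‖ ≤ ‖derH₂ i v‖ * ‖mulL w.val (embH u)‖ +
      ‖w.der i‖ * (‖derH i v‖ * ‖embH u‖) + ‖w.der i‖ * (‖embH v‖ * ‖derH i u‖) := by
  rw [(hasWeakDeriv_derH i u).inner_embH w v, (hasWeakDeriv_embH i u).inner_derH w v]
  refine (norm_sub_le _ _).trans (add_le_add ?_ (norm_inner_mulL_le _ _ _))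
  rw [norm_neg]
  refine (norm_sub_le _ _).trans (add_le_add ?_ (norm_inner_mulL_le _ _ _))
  rw [norm_neg]
  exact norm_inner_le_norm _ _

/-- The coefficient of order `j` of the time derivative of the amplitude, in terms of the
coefficients `U` of the amplitude and `X` of the gradient of the phase. -/
noncomputable def rhsCoef (U : ℕ → ℝ → L2) (X : Fin 2 → ℕ → ℝ → Linf × L2) (j : ℕ) (t : ℝ) : L2 :=
  -(∑ i, ∑ k ∈ Finset.range (j + 1), transport i (X i k t) (U (j - k) t)) +
    (Complex.I / 2) • ∑ i, derH₂ i (shiftCoef U j t)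

theorem exists_common_bound (a b : ℝ) (f g : Fin 2 → ℝ) :
    ∃ A : ℝ, a ≤ A ∧ b ≤ A ∧ (∀ i, f i ≤ A) ∧ ∀ i, g i ≤ A := by
  obtain ⟨A, hA⟩ := (Set.toFinite ({a, b} ∪ range f ∪ range g)).bddAbove
  exact ⟨A, hA (by simp), hA (by simp), fun i => hA (by simp), fun i => hA (by simp)⟩

theorem exists_opNorm_bound : ∃ A : ℝ, ‖embH‖ ≤ A ∧ ‖supH‖ ≤ A ∧ (∀ i, ‖derH i‖ ≤ A) ∧
    ∀ i, ‖derH₂ i‖ ≤ A :=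
  exists_common_bound _ _ (fun i => ‖derH i‖) (fun i => ‖derH₂ i‖)

theorem norm_apply_le {G : Type*} [NormedAddCommGroup G] [NormedSpace ℂ G] {L : L2 →L[ℂ] G}
    {A M : ℝ} (hA : ‖L‖ ≤ A) {u : L2} (hu : ‖u‖ ≤ M) : ‖L u‖ ≤ A * M :=
  (L.le_opNorm u).trans
    (mul_le_mul hA hu (norm_nonneg _) ((norm_nonneg _).trans hA))

/-- Bounds for the weighted energy production of the `j`-th coefficient: apart from the norms of the
coefficients, only the Lipschitz bound of the weight and the weighted norms of the coefficients of
lower order enter. -/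
theorem exists_energy_bound (j : ℕ) (M Λ S : ℝ) : ∃ C : ℝ, ∀ (U : ℕ → ℝ → L2)
    (X : Fin 2 → ℕ → ℝ → Linf × L2) (w : TestFun) (t : ℝ),
    (∀ m ≤ j, ‖U m t‖ ≤ M) → (∀ i, ∀ k ≤ j, ‖X i k t‖ ≤ M) →
    (∀ i, ∀ k ≤ j, HasWeakDeriv i (X i k t).1 (X i k t).2) → (∀ i, IsRealLinf (X i 0 t).1) →
    (∀ i, ‖w.der i‖ ≤ Λ) → (∀ m < j, ‖mulL w.val (embH (U m t))‖ ≤ S) →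
    2 * (⟪embH (U j t), mulL w.val (rhsCoef U X j t)⟫_ℂ).re ≤ C := by
  obtain ⟨A, a1, a2, a3, a4⟩ := exists_opNorm_bound
  obtain ⟨K₁, hK₁⟩ : ∃ K : ℝ,
      K = M * (A * M * S) + Λ * (A * M * (M * (A * M))) + 1 / 2 * (A * M * M * S) := ⟨_, rfl⟩
  obtain ⟨K₀, hK₀⟩ : ∃ K : ℝ, K = Λ * (A * M * (M * (A * M))) := ⟨_, rfl⟩
  obtain ⟨K₂, hK₂⟩ : ∃ K : ℝ,
      K = A * M * S + Λ * (A * M * (A * M)) + Λ * (A * M * (A * M)) := ⟨_, rfl⟩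
  refine ⟨2 * (K₀ + j * (2 * |K₁|) + |K₂|), fun U X w t hU hX hXd hXr hw hS => ?_⟩
  have hA0 : 0 ≤ A := (norm_nonneg _).trans a1
  have hM : 0 ≤ M := (norm_nonneg _).trans (hU j le_rfl)
  have hΛ : 0 ≤ Λ := (norm_nonneg _).trans (hw 0)
  have b1 : ∀ m ≤ j, ‖embH (U m t)‖ ≤ A * M := fun m hm => norm_apply_le a1 (hU m hm)
  have b2 : ∀ m ≤ j, ‖supH (U m t)‖ ≤ A * M := fun m hm => norm_apply_le a2 (hU m hm)
  have b3 : ∀ i, ∀ m ≤ j, ‖derH i (U m t)‖ ≤ A * M := fun i m hm => norm_apply_le (a3 i) (hU m hm)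
  have b4 : ∀ i, ∀ m ≤ j, ‖derH₂ i (U m t)‖ ≤ A * M := fun i m hm =>
    norm_apply_le (a4 i) (hU m hm)
  have x1 : ∀ i, ∀ k ≤ j, ‖(X i k t).1‖ ≤ M := fun i k hk => (norm_fst_le _).trans (hX i k hk)
  have x2 : ∀ i, ∀ k ≤ j, ‖(X i k t).2‖ ≤ M := fun i k hk => (norm_snd_le _).trans (hX i k hk)
  -- order `0` of the phase against the coefficient `j` itself: antisymmetry
  have t0 : ∀ i, -(2 * (⟪embH (U j t), mulL w.val (transport i (X i 0 t) (U j t))⟫_ℂ).re) ≤ K₀ := by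
    intro i
    rw [transport_self_eq (hXd i 0 (Nat.zero_le _)) (hXr i) w, neg_neg]
    refine (Complex.re_le_norm _).trans ((norm_inner_mulL_le _ _ _).trans ?_)
    rw [hK₀]
    gcongr
    · exact hw i
    · exact b1 j le_rfl
    · refine (norm_mulL_le _ _).trans ?_
      gcongr
      · exact x1 i 0 (Nat.zero_le _)
      · exact b1 j le_rfl
  -- higher orders of the phase meet lower orders of the amplitude, whose weighted norm is known
  have tk : ∀ i, ∀ k ∈ Finset.range j,
      -(⟪embH (U j t),
        mulL w.val (transport i (X i (k + 1) t) (U (j - (k + 1)) t))⟫_ℂ).re ≤ |K₁| := by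
    intro i k hk
    have hk : k < j := Finset.mem_range.1 hk
    have hS0 : 0 ≤ S := (norm_nonneg _).trans (hS (j - (k + 1)) (by omega))
    refine ((neg_le_abs _).trans (Complex.abs_re_le_norm _)).trans
      (((norm_transport_le (hXd i (k + 1) (by omega)) w _ _).trans ?_).trans (le_abs_self K₁))
    rw [hK₁]
    have c1 := hS (j - (k + 1)) (by omega)
    have c2 := b1 (j - (k + 1)) (by omega)
    have c3 := x1 i (k + 1) (by omega)
    have c4 := x2 i (k + 1) (by omega)
    have c5 := b1 j le_rfl
    have c6 := b2 j le_rfl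
    have c7 := b3 i j le_rfl
    have c8 := hw i
    gcongr
  have tL : ∀ i, ‖⟪embH (U j t), mulL w.val (derH₂ i (shiftCoef U j t))⟫_ℂ‖ ≤ |K₂| := by
    intro i
    rcases j with _ | j
    · simp [shiftCoef]
    · have hS0 : 0 ≤ S := (norm_nonneg _).trans (hS j (by omega))
      simp only [shiftCoef]
      refine ((norm_laplace_le i w _ _).trans ?_).trans (le_abs_self K₂)
      rw [hK₂]
      have c1 := hS j (by omega)
      have c2 := b1 j (by omega)
      have c3 := b3 i j (by omega)
      have c5 := b1 (j + 1) le_rfl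
      have c6 := b4 i (j + 1) le_rfl
      have c7 := b3 i (j + 1) le_rfl
      have c8 := hw i
      gcongr
  have hsum : ∀ i, -(2 * (⟪embH (U j t), mulL w.val
      (∑ k ∈ Finset.range (j + 1), transport i (X i k t) (U (j - k) t))⟫_ℂ).re) ≤
      K₀ + j * (2 * |K₁|) := by
    intro i
    rw [Finset.sum_range_succ', map_add, inner_add_right, map_sum, inner_sum, Complex.add_re,
      Complex.re_sum]
    have h1 := Finset.sum_le_sum (tk i)
    rw [Finset.sum_neg_distrib] at h1
    simp only [Finset.sum_const, Finset.card_range, nsmul_eq_mul] at h1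
    have h2 := t0 i
    simp only [Nat.sub_zero]
    linarith
  have hL : 2 * (⟪embH (U j t), mulL w.val
      ((Complex.I / 2) • ∑ i, derH₂ i (shiftCoef U j t))⟫_ℂ).re ≤ 2 * |K₂| := by
    refine mul_le_mul_of_nonneg_left ((Complex.re_le_norm _).trans ?_) zero_le_two
    rw [map_smul, inner_smul_right, norm_mul, map_sum, inner_sum, Fin.sum_univ_two]
    have h1 := norm_add_le_of_le (tL 0) (tL 1)
    have h2 : ‖(Complex.I / 2 : ℂ)‖ = 1 / 2 := by simp
    rw [h2]; linarith
  have e : (⟪embH (U j t), mulL w.val (rhsCoef U X j t)⟫_ℂ).re =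
      -(∑ i, (⟪embH (U j t), mulL w.val
        (∑ k ∈ Finset.range (j + 1), transport i (X i k t) (U (j - k) t))⟫_ℂ).re) +
      (⟪embH (U j t), mulL w.val ((Complex.I / 2) • ∑ i, derH₂ i (shiftCoef U j t))⟫_ℂ).re := by
    rw [rhsCoef, map_add, inner_add_right, map_neg, inner_neg_right, Complex.add_re,
      Complex.neg_re, map_sum (mulL w.val), inner_sum, Complex.re_sum]
  rw [e, Fin.sum_univ_two]
  have h0 := hsum 0
  have h1 := hsum 1
  linarith

/-! ### Weighted energies and truncated weights -/

/-- The weighted energy `∫ w |f|²`. -/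
noncomputable def energy (w : TestFun) (f : L2) : ℝ := (⟪f, mulL w.val f⟫_ℂ).re

theorem integrable_test_mul_sq (w : TestFun) (f : L2) :
    Integrable (fun x => w.fn x * ‖f x‖ ^ 2) := by
  have h := (integrable_inner_mulL f w.val f).re
  refine h.congr ?_
  filter_upwards [w.val_ae] with x hx
  rw [hx, mul_assoc, Complex.mul_conj, Complex.normSq_eq_norm_sq, ← Complex.ofReal_mul]
  exact Complex.ofReal_re _

theorem energy_eq (w : TestFun) (f : L2) : energy w f = ∫ x, w.fn x * ‖f x‖ ^ 2 := by
  have h := integrable_inner_mulL f w.val f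
  rw [energy, inner_mulL]
  refine (integral_re h).symm.trans (integral_congr_ae ?_)
  filter_upwards [w.val_ae] with x hx
  rw [hx, mul_assoc, Complex.mul_conj, Complex.normSq_eq_norm_sq, ← Complex.ofReal_mul]
  exact Complex.ofReal_re _

/-- The weighted norm `∫ w² |f|²` is an energy for a weight dominating `w²`. -/
theorem norm_mulL_sq_le_energy {w w' : TestFun} (h : ∀ x, w.fn x ^ 2 ≤ w'.fn x) (f : L2) :
    ‖mulL w.val f‖ ^ 2 ≤ energy w' f := by
  rw [energy_eq, ← inner_self_eq_norm_sq (𝕜 := ℂ), w.isReal_val.inner_mulL, inner_mulL]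
  have hint := integrable_inner_mulL f w.val (mulL w.val f)
  refine (integral_re hint).symm.trans_le ?_
  refine integral_mono_ae hint.re (integrable_test_mul_sq w' f) ?_
  filter_upwards [w.val_ae, coeFn_mulL w.val f] with x h1 h2
  have : w.val x * mulL w.val f x * (starRingEnd ℂ) (f x) =
      ((w.fn x ^ 2 * ‖f x‖ ^ 2 : ℝ) : ℂ) := by
    rw [h2, h1, mul_assoc, mul_assoc, Complex.mul_conj, Complex.normSq_eq_norm_sq]
    push_cast; ring
  rw [this]
  change (((w.fn x ^ 2 * ‖f x‖ ^ 2 : ℝ) : ℂ)).re ≤ _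
  rw [Complex.ofReal_re]
  exact mul_le_mul_of_nonneg_right (h x) (by positivity)

theorem hasDerivAt_energy (w : TestFun) {A : ℝ → L2} {R : L2} {t : ℝ} (h : HasDerivAt A R t) :
    HasDerivAt (fun t => energy w (A t)) (2 * (⟪A t, mulL w.val R⟫_ℂ).re) t := by
  have h1 : HasDerivAt (fun t => mulL w.val (A t)) (mulL w.val R) t :=
    ((mulL w.val).restrictScalars ℝ).hasFDerivAt.comp_hasDerivAt t h
  have h2 := h.inner ℂ h1
  have h3 := Complex.reCLM.hasFDerivAt.comp_hasDerivAt t h2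
  refine h3.congr_deriv ?_
  simp only [Complex.reCLM_apply, Complex.add_re]
  rw [← w.isReal_val.inner_mulL R (A t), ← inner_conj_symm (mulL w.val R), Complex.conj_re]
  ring

theorem continuous_energy (w : TestFun) : Continuous (energy w) := by
  unfold energy
  exact Complex.continuous_re.comp (by fun_prop)

/-- A bound for the energy production on `(0, t₀)` propagates to the energy on `[0, t₀]`. -/
theorem energy_le (w : TestFun) {A R : ℝ → L2} {t₀ C : ℝ}
    (hA : ContinuousOn A (Icc 0 t₀)) (hd : ∀ t ∈ Ioo 0 t₀, HasDerivAt A (R t) t)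
    (hC : ∀ t ∈ Ioo 0 t₀, 2 * (⟪A t, mulL w.val (R t)⟫_ℂ).re ≤ C) {t : ℝ} (ht : t ∈ Icc 0 t₀) :
    energy w (A t) ≤ energy w (A 0) + C * t := by
  have h := (convex_Icc (0 : ℝ) t₀).image_sub_le_mul_sub_of_deriv_le
    (f := fun t => energy w (A t)) ((continuous_energy w).comp_continuousOn hA) ?_ (C := C) ?_ 0
    ⟨le_rfl, ht.1.trans ht.2⟩ t ht ht.1
  · simp only [sub_zero] at h; linarith
  · rw [interior_Icc]
    exact fun t ht => (hasDerivAt_energy w (hd t ht)).differentiableAt.differentiableWithinAt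
  · rw [interior_Icc]
    intro t ht
    rw [(hasDerivAt_energy w (hd t ht)).deriv]
    exact hC t ht

/-- A smooth cutoff function: `1` on the unit ball, `0` outside the ball of radius `2`. -/
noncomputable def cutoff : ContDiffBump (0 : Plane) := ⟨1, 2, one_pos, one_lt_two⟩

/-- The truncated weight `(1 + |x|²) ^ (β / 2) χ(x / R)`. -/
noncomputable def weight (β R : ℝ) (hR : 1 ≤ R) : TestFun where
  fn x := (1 + ‖x‖ ^ 2) ^ (β / 2) * cutoff (R⁻¹ • x)
  smooth := by
    refine ContDiff.mul ?_ (cutoff.contDiff.comp (contDiff_const_smul _))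
    exact (contDiff_const.add (contDiff_norm_sq ℝ)).rpow_const_of_ne fun x => by positivity
  compact := by
    refine HasCompactSupport.mul_left ?_
    exact cutoff.hasCompactSupport.comp_homeomorph
      (Homeomorph.smulOfNeZero R⁻¹ (by positivity : R⁻¹ ≠ 0))

theorem weight_apply (β R : ℝ) (hR : 1 ≤ R) (x : Plane) :
    (weight β R hR).fn x = (1 + ‖x‖ ^ 2) ^ (β / 2) * cutoff (R⁻¹ • x) := rfl

theorem weight_nonneg (β R : ℝ) (hR : 1 ≤ R) (x : Plane) : 0 ≤ (weight β R hR).fn x :=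
  mul_nonneg (by positivity) cutoff.nonneg

theorem weight_le {β : ℝ} (hβ : 0 ≤ β) (R : ℝ) (hR : 1 ≤ R) (x : Plane) :
    (weight β R hR).fn x ≤ (1 + ‖x‖) ^ β := by
  rw [weight_apply]
  refine (mul_le_of_le_one_right (by positivity) cutoff.le_one).trans ?_
  calc (1 + ‖x‖ ^ 2) ^ (β / 2) ≤ ((1 + ‖x‖) ^ 2) ^ (β / 2) := by
        gcongr; nlinarith [norm_nonneg x]
    _ = (1 + ‖x‖) ^ β := by
        rw [← Real.rpow_natCast, ← Real.rpow_mul (by positivity)]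
        congr 1; push_cast; ring

theorem le_weight {β : ℝ} (hβ : 0 ≤ β) (hβ1 : β ≤ 1) {R : ℝ} (hR : 1 ≤ R) {x : Plane}
    (hx : ‖x‖ ≤ R) : (1 + ‖x‖) ^ β ≤ 2 * (weight β R hR).fn x := by
  have hc : cutoff (R⁻¹ • x) = 1 := by
    apply cutoff.one_of_mem_closedBall
    rw [mem_closedBall_zero_iff, norm_smul, norm_inv, Real.norm_of_nonneg (by linarith)]
    change R⁻¹ * ‖x‖ ≤ 1
    rw [inv_mul_le_iff₀ (by linarith)]; linarith
  rw [weight_apply, hc, mul_one]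
  calc (1 + ‖x‖) ^ β = ((1 + ‖x‖) ^ 2) ^ (β / 2) := by
        rw [← Real.rpow_natCast, ← Real.rpow_mul (by positivity)]
        congr 1; push_cast; ring
    _ ≤ (2 * (1 + ‖x‖ ^ 2)) ^ (β / 2) := by
        gcongr; nlinarith [sq_nonneg (1 - ‖x‖)]
    _ = 2 ^ (β / 2) * (1 + ‖x‖ ^ 2) ^ (β / 2) := by
        rw [Real.mul_rpow (by norm_num) (by positivity)]
    _ ≤ 2 * (1 + ‖x‖ ^ 2) ^ (β / 2) := by
        gcongr
        calc (2 : ℝ) ^ (β / 2) ≤ 2 ^ (1 : ℝ) := by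
              apply Real.rpow_le_rpow_of_exponent_le <;> linarith
          _ = 2 := Real.rpow_one _

/-- The square of a weight is dominated by the weight with twice the exponent. This is why the
exponent is halved at each order. -/
theorem weight_sq_le {β β' : ℝ} (h : 2 * β ≤ β') (R : ℝ) (hR : 1 ≤ R) (x : Plane) :
    (weight β R hR).fn x ^ 2 ≤ (weight β' R hR).fn x := by
  rw [weight_apply, weight_apply, mul_pow]
  have h1 : ((1 + ‖x‖ ^ 2) ^ (β / 2)) ^ 2 ≤ (1 + ‖x‖ ^ 2) ^ (β' / 2) := by
    rw [← Real.rpow_natCast, ← Real.rpow_mul (by positivity)]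
    apply Real.rpow_le_rpow_of_exponent_le
    · nlinarith [sq_nonneg ‖x‖]
    · push_cast; linarith
  have h2 : (cutoff (R⁻¹ • x)) ^ 2 ≤ cutoff (R⁻¹ • x) :=
    pow_le_of_le_one cutoff.nonneg cutoff.le_one two_ne_zero
  exact mul_le_mul h1 h2 (by positivity) (by positivity)

/-- The gradients of the truncated weights are bounded uniformly in the truncation parameter,
because the growth exponent is at most `1`. -/
theorem exists_weight_der_le : ∃ Λ : ℝ, ∀ β ∈ Ioc (0 : ℝ) 1, ∀ R (hR : 1 ≤ R) (i : Fin 2),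
    ‖(weight β R hR).der i‖ ≤ Λ := by
  have hcd : ContDiff ℝ ∞ (cutoff : Plane → ℝ) := cutoff.contDiff
  obtain ⟨M, hM⟩ := (cutoff.hasCompactSupport.fderiv (𝕜 := ℝ)).exists_bound_of_continuous
    (hcd.continuous_fderiv (by simp))
  have hM0 : 0 ≤ M := (norm_nonneg _).trans (hM 0)
  refine ⟨1 + 3 * M, fun β hβ R hR i => norm_Linf_le (by positivity) ?_⟩
  filter_upwards [(weight β R hR).der_ae i] with x hx
  rw [hx, Complex.norm_real]
  have hR0 : 0 < R := by linarith
  have hpos : (0 : ℝ) < 1 + ‖x‖ ^ 2 := by positivity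
  have d1 : HasFDerivAt (fun x : Plane => (1 + ‖x‖ ^ 2) ^ (β / 2))
      ((β / 2 * (1 + ‖x‖ ^ 2) ^ (β / 2 - 1)) • (2 • innerSL ℝ x)) x :=
    (((hasStrictFDerivAt_norm_sq x).hasFDerivAt).const_add 1).rpow_const (Or.inl hpos.ne')
  have d2 : HasFDerivAt (fun x : Plane => cutoff (R⁻¹ • x))
      ((fderiv ℝ cutoff (R⁻¹ • x)) ∘L (R⁻¹ • ContinuousLinearMap.id ℝ Plane)) x :=
    ((hcd.differentiable (by simp) _).hasFDerivAt).comp x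
      ((hasFDerivAt_id x).const_smul R⁻¹)
  have d := d1.fun_mul d2
  change ‖fderiv ℝ (fun x : Plane => (1 + ‖x‖ ^ 2) ^ (β / 2) * cutoff (R⁻¹ • x)) x _‖ ≤ _
  rw [d.fderiv]
  have e : ((1 + ‖x‖ ^ 2) ^ (β / 2) • ((fderiv ℝ cutoff (R⁻¹ • x)) ∘L
      (R⁻¹ • ContinuousLinearMap.id ℝ Plane)) + cutoff (R⁻¹ • x) •
      ((β / 2 * (1 + ‖x‖ ^ 2) ^ (β / 2 - 1)) • (2 • innerSL ℝ x))) (basisVec i) =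
      cutoff (R⁻¹ • x) * (β * (1 + ‖x‖ ^ 2) ^ (β / 2 - 1) * inner ℝ x (basisVec i)) +
      (1 + ‖x‖ ^ 2) ^ (β / 2) * (R⁻¹ * fderiv ℝ cutoff (R⁻¹ • x) (basisVec i)) := by
    simp
    ring
  rw [e]
  have hin : |inner ℝ x (basisVec i)| ≤ ‖x‖ := by
    simpa [norm_basisVec] using abs_real_inner_le_norm x (basisVec i)
  refine norm_add_le_of_le ?_ ?_
  · rw [Real.norm_eq_abs, abs_mul, abs_of_nonneg cutoff.nonneg, abs_mul, abs_mul,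
      abs_of_pos hβ.1, abs_of_pos (by positivity : (0 : ℝ) < (1 + ‖x‖ ^ 2) ^ (β / 2 - 1))]
    have hx1 : ‖x‖ ≤ (1 + ‖x‖ ^ 2) ^ (1 / 2 : ℝ) := by
      rw [← Real.sqrt_eq_rpow]
      exact Real.le_sqrt_of_sq_le (by linarith)
    have h3 : (1 + ‖x‖ ^ 2) ^ (β / 2 - 1) * |inner ℝ x (basisVec i)| ≤ 1 := by
      calc _ ≤ (1 + ‖x‖ ^ 2) ^ (β / 2 - 1) * (1 + ‖x‖ ^ 2) ^ (1 / 2 : ℝ) := by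
            gcongr; exact hin.trans hx1
        _ = (1 + ‖x‖ ^ 2) ^ (β / 2 - 1 + 1 / 2) := (Real.rpow_add hpos _ _).symm
        _ ≤ 1 := Real.rpow_le_one_of_one_le_of_nonpos (by nlinarith [sq_nonneg ‖x‖])
            (by linarith [hβ.2])
    calc _ = cutoff (R⁻¹ • x) * (β * ((1 + ‖x‖ ^ 2) ^ (β / 2 - 1) *
          |inner ℝ x (basisVec i)|)) := by ring
      _ ≤ 1 * (1 * 1) := by
          gcongr
          · exact mul_nonneg hβ.1.le (by positivity)
          · exact cutoff.le_one
          · exact hβ.2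
      _ = 1 := by norm_num
  · by_cases hx2 : ‖x‖ ≤ 2 * R
    · have h4 : (1 + ‖x‖ ^ 2) ^ (β / 2) ≤ 3 * R := by
        calc (1 + ‖x‖ ^ 2) ^ (β / 2) ≤ (1 + ‖x‖ ^ 2) ^ (1 / 2 : ℝ) := by
              apply Real.rpow_le_rpow_of_exponent_le
              · nlinarith [sq_nonneg ‖x‖]
              · linarith [hβ.2]
          _ ≤ 3 * R := by
              rw [← Real.sqrt_eq_rpow]
              refine Real.sqrt_le_iff.2 ⟨by positivity, ?_⟩
              nlinarith [norm_nonneg x]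
      have h5 : ‖fderiv ℝ cutoff (R⁻¹ • x) (basisVec i)‖ ≤ M := by
        refine (ContinuousLinearMap.le_opNorm _ _).trans ?_
        rw [norm_basisVec, mul_one]; exact hM _
      rw [norm_mul, norm_mul, norm_inv, Real.norm_of_nonneg hR0.le,
        Real.norm_of_nonneg (by positivity)]
      calc _ ≤ 3 * R * (R⁻¹ * M) := by gcongr
        _ = 3 * M := by field_simp
    · have : fderiv ℝ cutoff (R⁻¹ • x) = 0 := by
        by_contra hne
        have h6 : R⁻¹ • x ∈ tsupport (cutoff : Plane → ℝ) :=
          support_fderiv_subset ℝ (Function.mem_support.2 hne)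
        rw [cutoff.tsupport_eq, mem_closedBall_zero_iff, norm_smul, norm_inv,
          Real.norm_of_nonneg hR0.le] at h6
        change R⁻¹ * ‖x‖ ≤ 2 at h6
        rw [inv_mul_le_iff₀ hR0] at h6
        linarith
      rw [this]
      simp; positivity

/-- A function with uniformly bounded truncated energies has a finite weighted norm. -/
theorem integrable_of_energy_le {β : ℝ} (hβ : β ∈ Ioc (0 : ℝ) 1) (f : L2) {B : ℝ}
    (h : ∀ R (hR : 1 ≤ R), energy (weight β R hR) f ≤ B) :
    Integrable (fun x => (1 + ‖x‖) ^ β * ‖f x‖ ^ 2) := by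
  have hm : AEStronglyMeasurable (fun x => (1 + ‖x‖) ^ β * ‖f x‖ ^ 2) volume :=
    ((measurable_const.add measurable_norm).pow_const β).aestronglyMeasurable.mul
      ((Lp.aestronglyMeasurable f).norm.pow 2)
  have hle : ∀ R : ℝ, ∀ x ∈ Metric.closedBall (0 : Plane) R,
      ‖(1 + ‖x‖) ^ β * ‖f x‖ ^ 2‖ ≤
        2 * ((weight β (max R 1) (le_max_right _ _)).fn x * ‖f x‖ ^ 2) := by
    intro R x hx
    rw [Real.norm_of_nonneg (by positivity), ← mul_assoc]
    gcongr
    exact le_weight hβ.1.le hβ.2 _ ((mem_closedBall_zero_iff.1 hx).trans (le_max_left _ _))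
  have hi : ∀ R : ℝ, IntegrableOn (fun x => (1 + ‖x‖) ^ β * ‖f x‖ ^ 2)
      (Metric.closedBall (0 : Plane) R) := by
    intro R
    refine Integrable.mono' ((integrable_test_mul_sq (weight β (max R 1) (le_max_right _ _))
      f).const_mul 2).integrableOn hm.restrict ?_
    filter_upwards [ae_restrict_mem measurableSet_closedBall] with x hx
    exact hle R x hx
  refine AECover.integrable_of_integral_norm_bounded
    (aecover_closedBall (x := (0 : Plane)) tendsto_id) (2 * B) hi (Eventually.of_forall fun R => ?_)
  calc ∫ x in Metric.closedBall (0 : Plane) R, ‖(1 + ‖x‖) ^ β * ‖f x‖ ^ 2‖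
      ≤ ∫ x in Metric.closedBall (0 : Plane) R,
        2 * ((weight β (max R 1) (le_max_right _ _)).fn x * ‖f x‖ ^ 2) :=
        setIntegral_mono_on (hi R).norm ((integrable_test_mul_sq _ f).const_mul 2).integrableOn
          measurableSet_closedBall (hle R)
    _ ≤ ∫ x, 2 * ((weight β (max R 1) (le_max_right _ _)).fn x * ‖f x‖ ^ 2) := by
        refine setIntegral_le_integral ((integrable_test_mul_sq _ f).const_mul 2) ?_
        exact ae_of_all _ fun x => mul_nonneg zero_le_two
          (mul_nonneg (weight_nonneg _ _ _ _) (by positivity))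
    _ = 2 * energy (weight β (max R 1) (le_max_right _ _)) f := by
        rw [integral_const_mul, energy_eq]
    _ ≤ 2 * B := by gcongr; exact h _ _

theorem energy_weight_le {β : ℝ} (hβ : 0 ≤ β) (f : L2)
    (h : Integrable (fun x => (1 + ‖x‖) ^ β * ‖f x‖ ^ 2)) (R : ℝ) (hR : 1 ≤ R) :
    energy (weight β R hR) f ≤ ∫ x, (1 + ‖x‖) ^ β * ‖f x‖ ^ 2 := by
  rw [energy_eq]
  refine integral_mono (integrable_test_mul_sq _ f) h fun x => ?_
  exact mul_le_mul_of_nonneg_right (weight_le hβ R hR x) (by positivity)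

/-! ### Equations of the coefficients and propagation of the weighted bounds -/

theorem norm_le_of_enorm_le {E : Type*} [NormedAddCommGroup E] {x : E} {r : ℝ} (hr : 0 ≤ r)
    (h : ‖x‖ₑ ≤ ENNReal.ofReal r) : ‖x‖ ≤ r := by
  rwa [← ofReal_norm, ENNReal.ofReal_le_ofReal_iff hr] at h

theorem ContInH.continuousOn {s : ℝ} (hs : 2 ≤ s) {I : Set ℝ} {a : ℝ → Plane → ℂ}
    (h : ContInH s I a) {u : ℝ → L2} (hu : ∀ t ∈ I, RepH (a t) (u t)) : ContinuousOn u I := by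
  intro t ht
  have h0 := (h t ht).2
  rw [ContinuousWithinAt, tendsto_iff_edist_tendsto_0]
  refine tendsto_of_tendsto_of_tendsto_of_le_of_le' tendsto_const_nhds h0
    (Eventually.of_forall fun _ => zero_le) ?_
  filter_upwards [self_mem_nhdsWithin] with τ hτ
  rw [edist_eq_enorm_sub]
  refine RepH.enorm_le ?_ hs
  simpa [sub_eq_add_neg] using (hu τ hτ).add ((hu t ht).const_smul (-1))

theorem ContInField.continuousOn {s p : ℝ} (hs : 1 ≤ s) {I : Set ℝ} {V : ℝ → Fin 2 → Plane → ℂ}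
    (h : ContInField s p I V) {i : Fin 2} {X : ℝ → Linf × L2}
    (hX : ∀ t ∈ I, RepField i (V t i) (X t)) : ContinuousOn X I := by
  intro t ht
  have h0 := (h t ht).2
  rw [ContinuousWithinAt, tendsto_iff_edist_tendsto_0]
  refine tendsto_of_tendsto_of_tendsto_of_le_of_le' tendsto_const_nhds h0
    (Eventually.of_forall fun _ => zero_le) ?_
  filter_upwards [self_mem_nhdsWithin] with τ hτ
  rw [edist_eq_enorm_sub]
  refine RepField.enorm_le (i := i) ?_ hs p
  simpa [sub_eq_add_neg] using (hX τ hτ).add ((hX t ht).const_smul (-1))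

/-- An expansion measured in an extended norm which dominates the norm of `E`. -/
theorem UniformExpansion.of_enorm_le {E : Type*} [NormedAddCommGroup E] [NormedSpace ℂ E]
    {n : ℕ} {I : Set ℝ} {f : ℝ → ℝ → E} {c : ℕ → ℝ → E} {ν : ℝ → ℝ → ℝ≥0∞}
    (hν : ∀ ε ∈ Ioc (0 : ℝ) 1, ∀ t ∈ I,
      ‖f ε t - ∑ j ∈ Finset.range (n + 1), (ε : ℂ) ^ j • c j t‖ₑ ≤ ν ε t)
    (h : ∀ δ > 0, ∀ᶠ ε : ℝ in 𝓝[>] 0, ∀ t ∈ I, ν ε t ≤ ENNReal.ofReal (δ * ε ^ n)) :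
    UniformExpansion n I f c := by
  intro δ hδ
  filter_upwards [h δ hδ, Ioc_mem_nhdsGT (zero_lt_one (α := ℝ))] with ε h1 h2 t ht
  have hε : 0 < ε := h2.1
  refine norm_le_of_enorm_le (by positivity)
    (le_trans (le_of_eq ?_) ((hν ε h2 t ht).trans (h1 t ht)))
  congr 2
  refine Finset.sum_congr rfl fun j _ => ?_
  rw [← Complex.ofReal_pow, Complex.coe_smul]

/-- The time derivative in `H^σ` gives a time derivative in `L²`. -/
theorem HasTimeDerivInH.exists_hasDerivAt {σ : ℝ} (hσ : 0 ≤ σ) {I : Set ℝ} (hI : IsOpen I)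
    {a b : ℝ → Plane → ℂ} (h : HasTimeDerivInH σ I a b) {u : ℝ → L2}
    (hu : ∀ t ∈ I, RepH (a t) (u t)) {t : ℝ} (ht : t ∈ I) (hb : MemH σ (b t)) :
    ∃ D : L2, D =ᵐ[volume] b t ∧ HasDerivAt (fun τ => embH (u τ)) D t := by
  have hD := (eLpNorm_le_sobNorm hσ hb).1
  refine ⟨hD.toLp _, hD.coeFn_toLp, ?_⟩
  rw [hasDerivAt_iff_tendsto_slope_zero, tendsto_iff_edist_tendsto_0]
  have h0 := h t ht
  have hmem : ∀ᶠ k : ℝ in 𝓝[≠] 0, t + k ∈ I := by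
    have : Tendsto (fun k : ℝ => t + k) (𝓝[≠] 0) (𝓝 t) := by
      have h1 : Tendsto (fun k : ℝ => t + k) (𝓝 0) (𝓝 (t + 0)) :=
        (continuous_const.add continuous_id).tendsto 0
      rw [add_zero] at h1
      exact h1.mono_left nhdsWithin_le_nhds
    exact this.eventually (hI.mem_nhds ht)
  refine tendsto_of_tendsto_of_tendsto_of_le_of_le' tendsto_const_nhds h0
    (Eventually.of_forall fun _ => zero_le) ?_
  filter_upwards [hmem, h0.eventually (gt_mem_nhds ENNReal.zero_lt_top)] with k hk hfin
  refine le_trans (le_of_eq ?_) (eLpNorm_le_sobNorm hσ hfin).2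
  rw [edist_eq_enorm_sub, Lp.enorm_def]
  refine eLpNorm_congr_ae ?_
  filter_upwards [Lp.coeFn_sub (k⁻¹ • (embH (u (t + k)) - embH (u t))) (hD.toLp _),
    Lp.coeFn_smul k⁻¹ (embH (u (t + k)) - embH (u t)),
    Lp.coeFn_sub (embH (u (t + k))) (embH (u t)), hD.coeFn_toLp, hu _ hk, hu t ht]
    with x e1 e2 e3 e4 e5 e6
  simp only [e1, e2, e3, e4, e5, e6, Pi.sub_apply, Pi.smul_apply]
  rw [← Complex.ofReal_inv, Complex.coe_smul]

/-- The amplitude equation as an identity in `L²`. The weak derivatives furnished by `AmplitudeEq`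
are those of the representatives, by uniqueness. -/
theorem AmplitudeEq.eq_transport {ε : ℝ} {da a : Plane → ℂ} {φ : Plane → ℝ}
    (h : AmplitudeEq ε da a φ) {u : L2} (hu : RepH a u) {Y : Fin 2 → Linf × L2}
    (hY : ∀ i, RepField i (grad φ i) (Y i)) {D : L2} (hD : D =ᵐ[volume] da) :
    D = -(∑ i, transport i (Y i) u) + (Complex.I / 2) • (ε • ∑ i, derH₂ i u) := by
  obtain ⟨p, q, r, hpqr, heq⟩ := h
  have hp : ∀ i, p i =ᵐ[volume] derH i u := fun i =>
    (hpqr i).1.unique (hasWeakDeriv_embH i u) hu.symm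
  have hq : ∀ i, q i =ᵐ[volume] derH₂ i u := fun i =>
    (hpqr i).2.1.unique (hasWeakDeriv_derH i u) (hp i)
  have hr : ∀ i, r i =ᵐ[volume] (Y i).2 := fun i =>
    (hpqr i).2.2.unique (hY i).2 (ae_eq_refl _)
  have htr : ∀ i, (transport i (Y i) u : L2) =ᵐ[volume]
      fun x => grad φ i x * p i x + (1 / 2) * (a x * r i x) := by
    intro i
    unfold transport
    filter_upwards [Lp.coeFn_add (mulL (Y i).1 (derH i u)) ((1 / 2 : ℂ) • mulL (supH u) (Y i).2),
      Lp.coeFn_smul (1 / 2 : ℂ) (mulL (supH u) (Y i).2), coeFn_mulL (Y i).1 (derH i u),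
      coeFn_mulL (supH u) (Y i).2, supH_ae_eq u, hu, hp i, hr i, (hY i).1]
      with x e1 e2 e3 e4 e5 e6 e7 e8 e9
    simp only [e1, e2, e3, e4, e5, e6, e7, e8, e9, Pi.add_apply, Pi.smul_apply, smul_eq_mul]
  simp only [Fin.sum_univ_two] at heq ⊢
  apply Lp.ext
  set P := transport 0 (Y 0) u
  set Q := transport 1 (Y 1) u
  filter_upwards [hD, heq, htr 0, htr 1, hq 0, hq 1,
    Lp.coeFn_add (-(P + Q)) ((Complex.I / 2) • (ε • (derH₂ 0 u + derH₂ 1 u))),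
    Lp.coeFn_neg (P + Q), Lp.coeFn_add P Q,
    Lp.coeFn_smul (Complex.I / 2) (ε • (derH₂ 0 u + derH₂ 1 u)),
    Lp.coeFn_smul ε (derH₂ 0 u + derH₂ 1 u), Lp.coeFn_add (derH₂ 0 u) (derH₂ 1 u)]
    with x e1 e2 e3 e4 e5 e6 e7 e8 e9 e10 e11 e12
  simp only [e1, e7, e8, e9, e10, e11, e12, Pi.add_apply, Pi.smul_apply, Pi.neg_apply,
    smul_eq_mul, Complex.real_smul, ← e5, ← e6]
  have e3' : P x = _ := e3
  have e4' : Q x = _ := e4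
  linear_combination e2 + e3' + e4'

/-- `transport i` as a continuous bilinear map. -/
noncomputable def transportL (i : Fin 2) : (Linf × L2) →L[ℝ] L2 →L[ℝ] L2 :=
  (mulL.bilinearComp (ContinuousLinearMap.fst ℂ Linf L2) (derH i) +
    (1 / 2 : ℂ) • mulL.flip.bilinearComp
      (ContinuousLinearMap.snd ℂ Linf L2) supH).bilinearRestrictScalars ℝ

theorem transportL_apply (i : Fin 2) (X : Linf × L2) (u : L2) :
    transportL i X u = transport i X u := rfl

/-- The coefficients of the expansion solve the cascade of linear equations obtained by expanding
the amplitude equation. -/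
theorem hasDerivAt_embH_coef {n : ℕ} {I : Set ℝ} (hI : IsOpen I) {u : ℝ → ℝ → L2} {U : ℕ → ℝ → L2}
    {Y : Fin 2 → ℝ → ℝ → Linf × L2} {X : Fin 2 → ℕ → ℝ → Linf × L2}
    (hu : UniformExpansion n I u U) (hY : ∀ i, UniformExpansion n I (Y i) (X i))
    (hU : CoefBounded n I U) (hX : ∀ i, CoefBounded n I (X i))
    (h : ∀ ε ∈ Ioc (0 : ℝ) 1, ∀ t ∈ I, HasDerivAt (fun τ => embH (u ε τ))
      (-(∑ i, transport i (Y i ε t) (u ε t)) +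
        (Complex.I / 2) • (ε • ∑ i, derH₂ i (u ε t))) t)
    {j : ℕ} (hj : j ≤ n) {t : ℝ} (ht : t ∈ I) :
    HasDerivAt (fun τ => embH (U j τ)) (rhsCoef U X j t) t := by
  let lap : L2 →L[ℝ] L2 := (∑ i, derH₂ i).restrictScalars ℝ
  let mulI : L2 →L[ℝ] L2 := ((Complex.I / 2) • ContinuousLinearMap.id ℂ L2).restrictScalars ℝ
  have htr : UniformExpansion n I (fun ε t => ∑ i, transportL i (Y i ε t) (u ε t))
      (fun l t => ∑ i, ∑ k ∈ Finset.range (l + 1), transportL i (X i k t) (U (l - k) t)) :=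
    UniformExpansion.sum _ fun i _ => (hY i).bilin hu (hX i) hU (transportL i)
  have hlap := ((hu.clm lap).smul_self (hU.clm lap)).clm mulI
  have hneg := htr.clm (-ContinuousLinearMap.id ℝ L2)
  have hG := hneg.add hlap
  have hE := hu.clm (embH.restrictScalars ℝ)
  have key : ∀ ε ∈ Ioc (0 : ℝ) 1, ∀ t ∈ I, HasDerivAt (fun τ => embH.restrictScalars ℝ (u ε τ))
      ((-ContinuousLinearMap.id ℝ L2) (∑ i, transportL i (Y i ε t) (u ε t)) +
        mulI (ε • lap (u ε t))) t := by
    intro ε hε t ht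
    refine HasDerivAt.congr_deriv (h ε hε t ht) ?_
    simp [lap, mulI, transportL_apply]
  refine HasDerivAt.congr_deriv (hE.hasDerivAt hI hG key hj ht) ?_
  simp only [rhsCoef]
  congr 1
  cases j <;> simp [shiftCoef, lap, mulI]

theorem weight_exponent_mem {α : ℝ} (hα : α ∈ Ioc (0 : ℝ) 1) (j : ℕ) :
    α / 2 ^ j ∈ Ioc (0 : ℝ) 1 :=
  ⟨div_pos hα.1 (by positivity), (div_le_self hα.1.le (one_le_pow₀ one_le_two)).trans hα.2⟩

/-- Propagation of the weighted bounds, by induction on the order of the coefficient. The bound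
does not depend on the truncation radius `R`. -/
theorem exists_energy_weight_le {n N : ℕ} (hN : N ≤ n) {t₀ α : ℝ} (hα : α ∈ Ioc (0 : ℝ) 1)
    {U : ℕ → ℝ → L2} {X : Fin 2 → ℕ → ℝ → Linf × L2} (hU : CoefBounded n (Icc 0 t₀) U)
    (hX : ∀ i, CoefBounded n (Icc 0 t₀) (X i))
    (hcont : ∀ j ≤ n, ContinuousOn (U j) (Icc 0 t₀))
    (hderiv : ∀ j ≤ n, ∀ t ∈ Ioo 0 t₀, HasDerivAt (fun τ => embH (U j τ)) (rhsCoef U X j t) t)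
    (hweak : ∀ i, ∀ k ≤ n, ∀ t ∈ Ioo 0 t₀, HasWeakDeriv i (X i k t).1 (X i k t).2)
    (hreal : ∀ i, ∀ t ∈ Ioo 0 t₀, IsRealLinf (X i 0 t).1)
    (h0 : ∀ j ≤ N, ∃ B, ∀ R (hR : 1 ≤ R), energy (weight (α / 2 ^ j) R hR) (embH (U j 0)) ≤ B)
    (j : ℕ) (hj : j ≤ N) :
    ∃ B, ∀ t ∈ Icc 0 t₀, ∀ R (hR : 1 ≤ R),
      energy (weight (α / 2 ^ j) R hR) (embH (U j t)) ≤ B := by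
  induction j using Nat.strong_induction_on with
  | _ j ih =>
    choose! B hB using fun m (hm : m < j) => ih m hm (hm.le.trans hj)
    obtain ⟨B₀, hB₀⟩ := h0 j hj
    obtain ⟨M₁, hM₁, hU⟩ := hU
    choose M₂ hM₂ hX using hX
    obtain ⟨Λ, hΛ⟩ := exists_weight_der_le
    obtain ⟨C, hC⟩ := exists_energy_bound j (M₁ + ∑ i, M₂ i) Λ
      (∑ m ∈ Finset.range j, √|B m|)
    have hM₂s : ∀ i, M₂ i ≤ ∑ i, M₂ i := fun i =>
      Finset.single_le_sum (fun i _ => hM₂ i) (Finset.mem_univ i)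
    refine ⟨B₀ + |C| * t₀, fun t ht R hR => ?_⟩
    refine (energy_le (weight (α / 2 ^ j) R hR) (A := fun τ => embH (U j τ))
      (R := rhsCoef U X j) (C := C)
      (embH.continuous.comp_continuousOn (hcont j (hj.trans hN))) (hderiv j (hj.trans hN))
      (fun τ hτ => ?_) ht).trans ?_
    · have hτ' : τ ∈ Icc 0 t₀ := Ioo_subset_Icc_self hτ
      refine hC U X _ τ (fun m hm => ?_) (fun i k hk => ?_)
        (fun i k hk => hweak i k (by omega) τ hτ) (fun i => hreal i τ hτ)
        (fun i => hΛ _ (weight_exponent_mem hα j) R hR i) (fun m hm => ?_)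
      · exact (hU m (by omega) τ hτ').trans
          (le_add_of_nonneg_right (Finset.sum_nonneg fun i _ => hM₂ i))
      · exact (hX i k (by omega) τ hτ').trans
          ((hM₂s i).trans (le_add_of_nonneg_left hM₁))
      · -- `2 * (α / 2 ^ j) ≤ α / 2 ^ m`: the weight of order `m` controls the squared weight
        have hw : 2 * (α / 2 ^ j) ≤ α / 2 ^ m := by
          obtain ⟨d, rfl⟩ := Nat.exists_eq_add_of_lt hm
          rw [pow_succ, pow_add, mul_div_assoc', div_le_div_iff₀ (by positivity) (by positivity)]
          have : (1 : ℝ) ≤ 2 ^ d := one_le_pow₀ one_le_two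
          have h2 : 0 ≤ 2 * α * 2 ^ m := by have := hα.1; positivity
          nlinarith [mul_le_mul_of_nonneg_left this h2]
        have h1 := (norm_mulL_sq_le_energy (weight_sq_le hw R hR) (embH (U m τ))).trans
          (hB m hm τ hτ' R hR)
        refine (Real.le_sqrt_of_sq_le (h1.trans (le_abs_self _))).trans ?_
        exact Finset.single_le_sum (f := fun m => √|B m|) (fun _ _ => Real.sqrt_nonneg _)
          (Finset.mem_range.2 hm)
    · have : C * t ≤ |C| * t₀ :=
        mul_le_mul (le_abs_self C) ht.2 ht.1 (abs_nonneg C)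
      exact add_le_add (hB₀ R hR) this

/-! ### Propagation of spatial decay -/

theorem RepField.isRealLinf {i : Fin 2} {f : Plane → ℝ} {X : Linf × L2}
    (h : RepField i (grad f i) X) : IsRealLinf X.1 := by
  filter_upwards [h.1] with x hx
  rw [hx, grad, Complex.conj_ofReal]

theorem RepField.hasWeakDeriv {i : Fin 2} {f : Plane → ℂ} {X : Linf × L2} (h : RepField i f X) :
    HasWeakDeriv i X.1 X.2 :=
  h.2.congr h.1.symm (ae_eq_refl _)

theorem RepH.weightedL2_iff {f : Plane → ℂ} {u : L2} (h : RepH f u) (α : ℝ) (j : ℕ) :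
    WeightedL2 α j f ↔ Integrable fun x => (1 + ‖x‖) ^ (α / 2 ^ j) * ‖embH u x‖ ^ 2 :=
  integrable_congr (h.mono fun x hx => by simp only [hx])

end SchrodingerPoisson

open SchrodingerPoisson

theorem lemma4p3 (N : ℕ) (hN : 1 ≤ N) (lam : ℝ) (hlam : lam ≠ 0)
    (s p T : ℝ) (hT : 0 < T)
    (A : ℝ → SchrodingerPoisson.Plane → ℂ) (Φ : SchrodingerPoisson.Plane → ℝ)
    (hdata : SchrodingerPoisson.DataAssumption (2 * N) s p A Φ)
    (a : ℝ → ℝ → SchrodingerPoisson.Plane → ℂ) (φ : ℝ → ℝ → SchrodingerPoisson.Plane → ℝ)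
    (hsol : ∀ ε ∈ Set.Ioc (0 : ℝ) 1,
      SchrodingerPoisson.IsSolution lam ε s p T (A ε) Φ (a ε) (φ ε))
    (acoef : ℕ → ℝ → SchrodingerPoisson.Plane → ℂ)
    (φcoef : ℕ → ℝ → SchrodingerPoisson.Plane → ℝ)
    (hexp : SchrodingerPoisson.IsExpansion (2 * N) s T a φ acoef φcoef)
    (α : ℝ) (hα : α ∈ Set.Ioc (0 : ℝ) 1)
    (h0 : ∀ j ≤ N, SchrodingerPoisson.WeightedL2 α j (acoef j 0)) :
    ∀ t ∈ Set.Ico 0 T, ∀ j ≤ N, SchrodingerPoisson.WeightedL2 α j (acoef j t) := by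
  obtain ⟨n, hn⟩ : ∃ n, n = 2 * N := ⟨_, rfl⟩
  rw [← hn] at hdata hexp
  have hreg : ∀ j ≤ n, 3 < s - 2 * (j : ℝ) := fun j hj => by
    have : (j : ℝ) ≤ n := by exact_mod_cast hj
    linarith [hdata.regularity]
  have hs : 3 < s := by simpa using hreg 0 (Nat.zero_le n)
  -- representatives of the solution and of the coefficients
  have hu : ∀ ε ∈ Ioc (0 : ℝ) 1, ∀ t ∈ Ico 0 T, ∃ u, RepH (a ε t) u := fun ε hε t ht =>
    (exists_embH_of_sobNorm (by linarith) ((hsol ε hε).amplitude_cont t ht).1).imp fun _ h => h.1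
  have hU : ∀ j ≤ n, ∀ t ∈ Ico 0 T, ∃ u, RepH (acoef j t) u := fun j hj t ht =>
    (exists_embH_of_sobNorm (by linarith [hreg j hj]) (hexp.amplitude_mem j hj t ht).1).imp
      fun _ h => h.1
  have hY : ∀ i, ∀ ε ∈ Ioc (0 : ℝ) 1, ∀ t ∈ Ico 0 T, ∃ Y, RepField i (grad (φ ε t) i) Y :=
    fun i ε hε t ht => exists_repField (by linarith) ((hsol ε hε).phase_cont t ht).1 i
  have hX : ∀ i, ∀ j ≤ n, ∀ t ∈ Ico 0 T, ∃ X, RepField i (grad (φcoef j t) i) X := by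
    intro i j hj t ht
    obtain ⟨q, -, hq⟩ := hexp.phase_mem j hj
    exact exists_repField (by linarith [hreg j hj]) (hq t ht) i
  choose! u hu using hu
  choose! U hU using hU
  choose! Y hY using hY
  choose! X hX using hX
  have huU : UniformExpansion n (Ico 0 T) u U :=
    UniformExpansion.of_enorm_le (fun ε hε t ht => RepH.enorm_le
      ((hu ε hε t ht).sub_sum _ _ fun j hj =>
        hU j (Nat.lt_succ_iff.1 (Finset.mem_range.1 hj)) t ht)
      (by linarith [hreg n le_rfl])) hexp.amplitude_expansion
  have hYX : ∀ i, UniformExpansion n (Ico 0 T) (Y i) (X i) := by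
    intro i
    obtain ⟨q, -, hq⟩ := hexp.gradient_expansion
    refine UniformExpansion.of_enorm_le (fun ε hε t ht => RepField.enorm_le (i := i) ?_
      (by linarith [hreg n le_rfl]) q) hq
    simpa using (hY i ε hε t ht).sub_sum (Finset.range (n + 1)) (fun j => (ε : ℂ) ^ j) fun j hj =>
      hX i j (Nat.lt_succ_iff.1 (Finset.mem_range.1 hj)) t ht
  -- no bounds uniform up to time `T` are available: work on compact subintervals
  intro t ht
  obtain ⟨t₀, htt₀, ht₀T⟩ := exists_between ht.2
  have ht₀ : 0 < t₀ := ht.1.trans_lt htt₀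
  have hsub : Icc 0 t₀ ⊆ Ico 0 T := fun τ hτ => ⟨hτ.1, hτ.2.trans_lt ht₀T⟩
  have hsub' : Ioo 0 t₀ ⊆ Ico 0 T := Ioo_subset_Icc_self.trans hsub
  have hUb : CoefBounded n (Icc 0 t₀) U := huU.coefBounded hsub fun ε hε =>
    isCompact_Icc.exists_bound_of_continuousOn
      (((hsol ε hε).amplitude_cont.continuousOn (by linarith) (hu ε hε)).mono hsub)
  have hXb : ∀ i, CoefBounded n (Icc 0 t₀) (X i) := fun i => (hYX i).coefBounded hsub fun ε hε =>
    isCompact_Icc.exists_bound_of_continuousOn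
      (((hsol ε hε).phase_cont.continuousOn (by linarith) (hY i ε hε)).mono hsub)
  have hderiv : ∀ j ≤ n, ∀ τ ∈ Ioo 0 t₀,
      HasDerivAt (fun τ => embH (U j τ)) (rhsCoef U X j τ) τ := by
    intro j hj τ hτ
    refine hasDerivAt_embH_coef isOpen_Ioo (huU.mono hsub') (fun i => (hYX i).mono hsub')
      (hUb.mono Ioo_subset_Icc_self) (fun i => (hXb i).mono Ioo_subset_Icc_self)
      (fun ε hε τ hτ => ?_) hj hτ
    obtain ⟨da, hda, hder, heq⟩ := (hsol ε hε).amplitude_eq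
    have hτT : τ ∈ Ioo 0 T := ⟨hτ.1, hτ.2.trans ht₀T⟩
    obtain ⟨D, hD, hD'⟩ := hder.exists_hasDerivAt (by linarith) isOpen_Ioo
      (fun r hr => hu ε hε r (Ioo_subset_Ico_self hr)) hτT (hda τ hτT).1
    rwa [← (heq τ hτT).eq_transport (hu ε hε τ (hsub' hτ)) (fun i => hY i ε hε τ (hsub' hτ)) hD]
  intro j hj
  have hNn : N ≤ n := by omega
  have h0T : (0 : ℝ) ∈ Ico 0 T := ⟨le_rfl, hT⟩
  obtain ⟨B, hB⟩ := exists_energy_weight_le hNn hα hUb hXb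
    (fun j hj => ((hexp.amplitude_mem j hj).continuousOn (by linarith [hreg j hj])
      (hU j hj)).mono hsub) hderiv
    (fun i k hk τ hτ => (hX i k hk τ (hsub' hτ)).hasWeakDeriv)
    (fun i τ hτ => (hX i 0 (Nat.zero_le n) τ (hsub' hτ)).isRealLinf)
    (fun j hj => ⟨_, fun R hR => energy_weight_le (weight_exponent_mem hα j).1.le _
      (((hU j (hj.trans hNn) 0 h0T).weightedL2_iff α j).1 (h0 j hj)) R hR⟩) j hj
  exact ((hU j (hj.trans hNn) t ht).weightedL2_iff α j).2
    (integrable_of_energy_le (weight_exponent_mem hα j) _ (hB t ⟨ht.1, htt₀.le⟩))
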